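/- Let $\Gamma=(V,E,s,r)$ be a finite directed graph, $F$ a field and $L(\Gamma)$ the Leavitt path algebra of $\Gamma$ over $F$, $\mathbb Z$-graded by $\deg v=0$, $\deg e=1$, $\deg e^*=-1$. Vertices are the paths of length $0$; a vertex $w$ is a descendant of $v$ if there is a path from $v$ to $w$. A nonempty set $W\subseteq V$ is hereditary if it contains all descendants of its elements; the minimal hereditary sets $W_1,\dots,W_k$ form the frame of $\Gamma$. A specialization $\gamma$ chooses for each non-sink $v$ an edge $\gamma(v)$ with source $v$; the chosen edges are called special, and a path $e_1\cdots e_n$ with $n\ge 1$ is special if all its edges are. Fix a specialization $\gamma$ such that there are only finitely many special paths $e_1\cdots e_n$ with $s(e_1),\dots,s(e_n)\notin W_1\cup\dots\cup W_k$. For a path $p$ let $l(p)$ be its length and $\mathrm{sd}(p)$ the length of its longest final segment consisting of special edges. For real $n,s,d\ge 0$ let $V_{n,s,d}\subseteq L(\Gamma)$ be the $F$-span of all $pq^*$ with $l(p)+l(q)\ge n$, $\mathrm{sd}(p)+\mathrm{sd}(q)\le s$ and $|l(p)-l(q)|\le d$, and for $k\ge 1$ let $V_k=\sum\{V_{n,s,d}\mid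 n\ge k(s+d+1)\}$. The $V_k$ form a basis of neighborhoods of $0$ of an algebra topology on $L(\Gamma)$. Let $\overline{L(\Gamma)}$ be the completion, $\overline{L(\Gamma)_i}$ the closure in it of the homogeneous component $L(\Gamma)_i$, and $\widehat L(\Gamma)=\sum_{i\in\mathbb Z}\overline{L(\Gamma)_i}$, a subalgebra of $\overline{L(\Gamma)}$ with the subspace topology. For $W\subseteq V$ let $\mathrm{Arr}(W)$ be the set of paths $p$ that end in $W$ and have no earlier vertex in $W$, let $e(W)=\sum_{p\in\mathrm{Arr}(W)}pp^*\in\widehat L(\Gamma)$ (so $e(\emptyset)=0$), let $W^\perp$ be the set of vertices that have no descendant in $W$, and let $I(W)$ be the closed two-sided ideal of $\widehat L(\Gamma)$ generated by $W$. Then: 1. For every hereditary $W$ the sum $e(W)$ converges in $\widehat L(\Gamma)$ and is a central idempotent. 2. If $W'\subseteq W''$ are hereditary and every vertex of $W''$ has a descendant in $W'$, then $e(W')=e(W'')$. 3. For every hereditary $W$ the set $W^\perp$ is empty (and then $e(W^\perp)=0$) or hereditary, and $e(W)e(W^\perp)=e(W^\perp)e(W)=0$, $e(W)+e(W^\perp)=1$.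 4. For every hereditary $W$, $e(W)=e((W^\perp)^\perp)$. 5. For every hereditary $W$, $I(W)=e(W)\widehat L(\Gamma)$. 6. For every hereditary $W$, $\widehat L(\Gamma)=I(W)\oplus I(W^\perp)$. 7. $\widehat L(\Gamma)=I(W_1)\oplus\cdots\oplus I(W_k)$. -/

import Mathlib

/-- A directed graph with vertex set `V`, edge set `E`, source map `s` and range map `r`
(loops and multiple edges are allowed). Finiteness of `V` and `E` is assumed where needed. -/
structure DirGraph (V E : Type*) where
  /-- the source of an edge -/
  s : E → V
  /-- the range of an edge -/
  r : E → V

namespace DirGraph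

variable {V E : Type*}

/-! ### Paths, descendants, hereditary sets -/

/-- A vertex is a sink if no edge starts at it. -/
def IsSink (Γ : DirGraph V E) (v : V) : Prop := ∀ e, Γ.s e ≠ v

/-- `e₁ ⋯ eₙ` is a path that starts at `v`: `s e₁ = v` and `r eᵢ = s eᵢ₊₁`. -/
def IsWalk (Γ : DirGraph V E) : V → List E → Prop
  | _, [] => True
  | v, e :: l => Γ.s e = v ∧ Γ.IsWalk (Γ.r e) l

/-- The last vertex of `e₁ ⋯ eₙ` started at `v`; it is `v` itself for the empty list. -/
def endpoint (Γ : DirGraph V E) : V → List E → V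
  | v, [] => v
  | _, e :: l => Γ.endpoint (Γ.r e) l

/-- A path of `Γ`: a starting vertex with a compatible list of edges. The paths of length `0` are
the vertices. -/
@[ext] structure Path (Γ : DirGraph V E) where
  /-- the vertex `s(p)` at which the path starts -/
  src : V
  /-- the edges of the path, in order -/
  edges : List E
  isWalk : Γ.IsWalk src edges

/-- The vertex `r(p)` at which the path `p` ends. -/
def Path.tgt {Γ : DirGraph V E} (p : Γ.Path) : V := Γ.endpoint p.src p.edges

/-- The length `l(p)` of a path. -/
def Path.length {Γ : DirGraph V E} (p : Γ.Path) : ℕ := p.edges.length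

/-- `w` is a descendant of `v` if some path (possibly of length `0`) leads from `v` to `w`. -/
def IsDescendant (Γ : DirGraph V E) (v w : V) : Prop := ∃ p : Γ.Path, p.src = v ∧ p.tgt = w

/-- A hereditary set of vertices: nonempty, and closed under taking descendants. -/
def IsHereditary (Γ : DirGraph V E) (W : Set V) : Prop :=
  W.Nonempty ∧ ∀ w ∈ W, ∀ u, Γ.IsDescendant w u → u ∈ W

/-- The frame of `Γ`: the collection of all minimal hereditary sets of vertices. -/
def frame (Γ : DirGraph V E) : Set (Set V) := {W | Minimal Γ.IsHereditary W}

/-- `W^⊥`: the set of all vertices without a descendant in `W`. -/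
def perp (Γ : DirGraph V E) (W : Set V) : Set V := {v | ∀ w ∈ W, ¬ Γ.IsDescendant v w}

/-- The set `Arr(W)` of arrival paths in `W`: the end of the path is its first vertex in `W`.
Every vertex of `W` is an arrival path of length `0`. -/
def arr (Γ : DirGraph V E) (W : Set V) : Set Γ.Path :=
  {p | p.tgt ∈ W ∧ ∀ e ∈ p.edges, Γ.s e ∉ W}

theorem IsWalk.append {Γ : DirGraph V E} {l t : List E} : ∀ {v : V}, Γ.IsWalk v l →
    Γ.IsWalk (Γ.endpoint v l) t → Γ.IsWalk v (l ++ t) := by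
  induction l with
  | nil => intro v _ h; exact h
  | cons e l ih => intro v h h'; exact ⟨h.1, ih h.2 h'⟩

theorem IsWalk.right {Γ : DirGraph V E} {l t : List E} : ∀ {v : V}, Γ.IsWalk v (l ++ t) →
    Γ.IsWalk (Γ.endpoint v l) t := by
  induction l with
  | nil => intro v h; exact h
  | cons e l ih => intro v h; exact ih h.2

/-! ### Specializations -/

/-- A specialization: a choice, for each vertex which is not a sink, of an edge starting at it. -/
structure Specialization (Γ : DirGraph V E) where
  /-- the chosen edge -/
  toFun : {v : V // ¬ Γ.IsSink v} → E
  source_eq : ∀ v, Γ.s (toFun v) = v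

namespace Specialization

variable {Γ : DirGraph V E}

/-- The special edges are those in the image of the specialization. -/
def IsSpecial (γ : Γ.Specialization) (e : E) : Prop := e ∈ Set.range γ.toFun

/-- A special path: a path of length at least `1`, all of whose edges are special. -/
def IsSpecialPath (γ : Γ.Specialization) (p : Γ.Path) : Prop :=
  p.edges ≠ [] ∧ ∀ e ∈ p.edges, γ.IsSpecial e

open Classical in
/-- The length of the longest final segment that consists of special edges. -/
noncomputable def sdList (γ : Γ.Specialization) (l : List E) : ℕ :=
  (l.rtakeWhile fun e => decide (γ.IsSpecial e)).length

/-- `sd(p)`: the length of the longest final segment of `p` that consists of special edges. -/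
noncomputable def sd (γ : Γ.Specialization) (p : Γ.Path) : ℕ := γ.sdList p.edges

theorem sdList_append_le (γ : Γ.Specialization) (l t : List E) : γ.sdList (l ++ t) ≤ γ.sdList l + γ.sdList t := by
  classical
  induction t using List.reverseRecOn with
  | nil => simp [sdList]
  | append_singleton t e ih =>
    rw [← List.append_assoc]
    unfold sdList at ih ⊢
    rw [List.rtakeWhile_concat, List.rtakeWhile_concat]
    split_ifs
    · simp only [List.length_append, List.length_singleton]; omega
    · simp

theorem sdList_le_append (γ : Γ.Specialization) (l t : List E) : γ.sdList t ≤ γ.sdList (l ++ t) := by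
  classical
  induction t using List.reverseRecOn with
  | nil => simp [sdList]
  | append_singleton t e ih =>
    rw [← List.append_assoc]
    unfold sdList at ih ⊢
    rw [List.rtakeWhile_concat, List.rtakeWhile_concat]
    split_ifs
    · simp only [List.length_append, List.length_singleton]; omega
    · simp

/-- The standing assumption on specializations: there are only finitely many special paths
`e₁ ⋯ eₙ` such that no `s(eᵢ)` lies in a minimal hereditary set. -/
def IsAdmissible (γ : Γ.Specialization) : Prop :=
  {p : Γ.Path | γ.IsSpecialPath p ∧ ∀ e ∈ p.edges, Γ.s e ∉ ⋃₀ Γ.frame}.Finite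

end Specialization

/-! ### The Leavitt path algebra -/

/-- The generators `v`, `e`, `e*` of the Leavitt path algebra. -/
inductive Gen (V E : Type*)
  | vert (v : V) : Gen V E
  | edge (e : E) : Gen V E
  | ghost (e : E) : Gen V E

/-- The degrees of the generators: `deg v = 0`, `deg e = 1`, `deg e* = -1`. -/
def Gen.deg : Gen V E → ℤ
  | .vert _ => 0
  | .edge _ => 1
  | .ghost _ => -1

section Algebra

variable [Fintype V] [Fintype E] (F : Type*) [Field F]

open Classical in
/-- The defining relations of the Leavitt path algebra. For a finite graph the algebra given by
the other relations has the unit element `∑ v`; since `FreeAlgebra` is the free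
unital algebra, this has to be said in the relation `one`. -/
inductive Rel (Γ : DirGraph V E) :
    FreeAlgebra F (Gen V E) → FreeAlgebra F (Gen V E) → Prop
  | vert_self (v : V) : Rel Γ
      (FreeAlgebra.ι F (Gen.vert v) * FreeAlgebra.ι F (Gen.vert v)) (FreeAlgebra.ι F (Gen.vert v))
  | vert_ne (v w : V) : v ≠ w → Rel Γ
      (FreeAlgebra.ι F (Gen.vert v) * FreeAlgebra.ι F (Gen.vert w)) 0
  | source_edge (e : E) : Rel Γ
      (FreeAlgebra.ι F (Gen.vert (Γ.s e)) * FreeAlgebra.ι F (Gen.edge e))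
      (FreeAlgebra.ι F (Gen.edge e))
  | edge_range (e : E) : Rel Γ
      (FreeAlgebra.ι F (Gen.edge e) * FreeAlgebra.ι F (Gen.vert (Γ.r e)))
      (FreeAlgebra.ι F (Gen.edge e))
  | range_ghost (e : E) : Rel Γ
      (FreeAlgebra.ι F (Gen.vert (Γ.r e)) * FreeAlgebra.ι F (Gen.ghost e))
      (FreeAlgebra.ι F (Gen.ghost e))
  | ghost_source (e : E) : Rel Γ
      (FreeAlgebra.ι F (Gen.ghost e) * FreeAlgebra.ι F (Gen.vert (Γ.s e)))
      (FreeAlgebra.ι F (Gen.ghost e))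
  | ghost_edge_self (e : E) : Rel Γ
      (FreeAlgebra.ι F (Gen.ghost e) * FreeAlgebra.ι F (Gen.edge e))
      (FreeAlgebra.ι F (Gen.vert (Γ.r e)))
  | ghost_edge_ne (e f : E) : e ≠ f → Rel Γ
      (FreeAlgebra.ι F (Gen.ghost e) * FreeAlgebra.ι F (Gen.edge f)) 0
  | vert_eq_sum (v : V) : ¬ Γ.IsSink v → Rel Γ
      (FreeAlgebra.ι F (Gen.vert v))
      (∑ e with Γ.s e = v, FreeAlgebra.ι F (Gen.edge e) * FreeAlgebra.ι F (Gen.ghost e))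
  | one : Rel Γ (∑ v, FreeAlgebra.ι F (Gen.vert v)) 1

/-- The Leavitt path algebra `L(Γ)` of a finite graph over the field `F`. -/
def LPA (Γ : DirGraph V E) : Type _ := RingQuot (Rel F Γ)

namespace LPA

variable (Γ : DirGraph V E)

noncomputable instance instRing : Ring (LPA F Γ) := inferInstanceAs (Ring (RingQuot (Rel F Γ)))

noncomputable instance instAlgebra : Algebra F (LPA F Γ) :=
  inferInstanceAs (Algebra F (RingQuot (Rel F Γ)))

/-- The projection from the free algebra. -/
noncomputable def proj : FreeAlgebra F (Gen V E) →ₐ[F] LPA F Γ := RingQuot.mkAlgHom F (Rel F Γ)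

/-- The image of a generator in `L(Γ)`. -/
noncomputable def gen (x : Gen V E) : LPA F Γ := proj F Γ (FreeAlgebra.ι F x)

/-- The homogeneous component `L(Γ)_i`: the span of all products of generators of total
degree `i`. -/
noncomputable def homog (i : ℤ) : Submodule F (LPA F Γ) :=
  Submodule.span F {x | ∃ l : List (Gen V E),
    (l.map Gen.deg).sum = i ∧ x = (l.map (gen F Γ)).prod}

/-- The product `v e₁ ⋯ eₙ` in `L(Γ)`. -/
noncomputable def elt (v : V) (l : List E) : LPA F Γ :=
  gen F Γ (.vert v) * (l.map fun e => gen F Γ (.edge e)).prod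

/-- The product `eₙ* ⋯ e₁* v` in `L(Γ)`. -/
noncomputable def eltStar (v : V) (l : List E) : LPA F Γ :=
  (l.reverse.map fun e => gen F Γ (.ghost e)).prod * gen F Γ (.vert v)

variable {Γ}

/-- The element `p q*` of `L(Γ)`, for two paths `p` and `q`. -/
noncomputable def mulStar (p q : Γ.Path) : LPA F Γ :=
  elt F Γ p.src p.edges * eltStar F Γ q.src q.edges

end LPA

namespace Specialization

variable {Γ : DirGraph V E} (γ : Γ.Specialization)

/-- `V_{n,s,d}`: the span of all `p q*` with `l(p) + l(q) ≥ n`, `sd(p) + sd(q) ≤ s` and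
`|l(p) - l(q)| ≤ d`. -/
noncomputable def nbhdAux (n s d : ℝ) : Submodule F (LPA F Γ) :=
  Submodule.span F {x | ∃ p q : Γ.Path, n ≤ (p.length : ℝ) + q.length ∧
    (γ.sd p : ℝ) + γ.sd q ≤ s ∧ |(p.length : ℝ) - q.length| ≤ d ∧ x = LPA.mulStar F p q}

/-- `V_k`: the sum of all `V_{n,s,d}` with `n, s, d ≥ 0` and `n ≥ k (s + d + 1)`. -/
noncomputable def nbhd (k : ℝ) : Submodule F (LPA F Γ) :=
  ⨆ t : {t : ℝ × ℝ × ℝ // 0 ≤ t.1 ∧ 0 ≤ t.2.1 ∧ 0 ≤ t.2.2 ∧ k * (t.2.1 + t.2.2 + 1) ≤ t.1},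
    γ.nbhdAux F t.1.1 t.1.2.1 t.1.2.2

end Specialization

/-! ### Helper facts: the topology is compatible with the algebra structure -/

variable {F}

namespace LPA

variable {Γ : DirGraph V E}

theorem proj_rel {a b : FreeAlgebra F (Gen V E)} (h : Rel F Γ a b) : proj F Γ a = proj F Γ b :=
  RingQuot.mkAlgHom_rel F h

theorem vert_self (v : V) : gen F Γ (.vert v) * gen F Γ (.vert v) = gen F Γ (.vert v) := by
  have := proj_rel (Rel.vert_self (F := F) (Γ := Γ) v); rwa [map_mul] at this

theorem vert_ne {v w : V} (h : v ≠ w) : gen F Γ (.vert v) * gen F Γ (.vert w) = 0 := by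
  have := proj_rel (Rel.vert_ne (F := F) (Γ := Γ) v w h); rwa [map_mul, map_zero] at this

theorem source_edge (e : E) : gen F Γ (.vert (Γ.s e)) * gen F Γ (.edge e) = gen F Γ (.edge e) := by
  have := proj_rel (Rel.source_edge (F := F) (Γ := Γ) e); rwa [map_mul] at this

theorem edge_range (e : E) : gen F Γ (.edge e) * gen F Γ (.vert (Γ.r e)) = gen F Γ (.edge e) := by
  have := proj_rel (Rel.edge_range (F := F) (Γ := Γ) e); rwa [map_mul] at this

theorem range_ghost (e : E) :
    gen F Γ (.vert (Γ.r e)) * gen F Γ (.ghost e) = gen F Γ (.ghost e) := by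
  have := proj_rel (Rel.range_ghost (F := F) (Γ := Γ) e); rwa [map_mul] at this

theorem ghost_source (e : E) :
    gen F Γ (.ghost e) * gen F Γ (.vert (Γ.s e)) = gen F Γ (.ghost e) := by
  have := proj_rel (Rel.ghost_source (F := F) (Γ := Γ) e); rwa [map_mul] at this

theorem ghost_edge_self (e : E) :
    gen F Γ (.ghost e) * gen F Γ (.edge e) = gen F Γ (.vert (Γ.r e)) := by
  have := proj_rel (Rel.ghost_edge_self (F := F) (Γ := Γ) e); rwa [map_mul] at this

theorem ghost_edge_ne {e f : E} (h : e ≠ f) : gen F Γ (.ghost e) * gen F Γ (.edge f) = 0 := by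
  have := proj_rel (Rel.ghost_edge_ne (F := F) (Γ := Γ) e f h); rwa [map_mul, map_zero] at this

theorem sum_vert : ∑ v, gen F Γ (.vert v) = 1 := by
  have := proj_rel (Rel.one (F := F) (Γ := Γ)); rwa [map_sum, map_one] at this

theorem proj_surjective : Function.Surjective (proj F Γ) := RingQuot.mkAlgHom_surjective F _

theorem elt_nil (v : V) : elt F Γ v [] = gen F Γ (.vert v) := by simp [elt]

theorem eltStar_nil (v : V) : eltStar F Γ v [] = gen F Γ (.vert v) := by simp [eltStar]

theorem elt_cons (e : E) (l : List E) :
    elt F Γ (Γ.s e) (e :: l) = gen F Γ (.edge e) * elt F Γ (Γ.r e) l := by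
  simp only [elt, List.map_cons, List.prod_cons, ← mul_assoc, source_edge, edge_range]

theorem eltStar_cons (e : E) (l : List E) :
    eltStar F Γ (Γ.s e) (e :: l) = eltStar F Γ (Γ.r e) l * gen F Γ (.ghost e) := by
  simp [eltStar, mul_assoc, ghost_source, range_ghost]

theorem elt_append {t : List E} : ∀ {l : List E} {v : V}, Γ.IsWalk v l →
    elt F Γ v l * elt F Γ (Γ.endpoint v l) t = elt F Γ v (l ++ t) := by
  intro l
  induction l with
  | nil =>
    intro v _
    rw [elt_nil, endpoint, List.nil_append, elt, ← mul_assoc, vert_self]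
  | cons e l ih =>
    rintro v ⟨rfl, h⟩
    rw [endpoint, List.cons_append, elt_cons, elt_cons, mul_assoc, ih h]

theorem eltStar_append {t : List E} : ∀ {l : List E} {v : V}, Γ.IsWalk v l →
    eltStar F Γ (Γ.endpoint v l) t * eltStar F Γ v l = eltStar F Γ v (l ++ t) := by
  intro l
  induction l with
  | nil =>
    intro v _
    rw [eltStar_nil, endpoint, List.nil_append, eltStar, mul_assoc, vert_self]
  | cons e l ih =>
    rintro v ⟨rfl, h⟩
    rw [endpoint, List.cons_append, eltStar_cons, eltStar_cons, ← mul_assoc, ih h]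

theorem elt_mul_elt_ne {t l : List E} {v w : V} (h : Γ.IsWalk v l) (hw : Γ.endpoint v l ≠ w) :
    elt F Γ v l * elt F Γ w t = 0 := by
  have := elt_append (F := F) (t := []) h
  rw [List.append_nil, elt_nil] at this
  rw [← this, elt, mul_assoc, mul_assoc, elt, ← mul_assoc (gen F Γ _) (gen F Γ _), vert_ne hw,
    zero_mul, mul_zero, mul_zero]

theorem eltStar_mul_eltStar_ne {t l : List E} {v w : V} (h : Γ.IsWalk v l)
    (hw : Γ.endpoint v l ≠ w) : eltStar F Γ w t * eltStar F Γ v l = 0 := by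
  have := eltStar_append (F := F) (t := []) h
  rw [List.append_nil, eltStar_nil] at this
  rw [← this, eltStar, mul_assoc, ← mul_assoc (gen F Γ _) (gen F Γ _), vert_ne hw.symm,
    zero_mul, mul_zero]

theorem eltStar_mul_elt : ∀ {l l' : List E} {v v' : V}, Γ.IsWalk v l → Γ.IsWalk v' l' →
    eltStar F Γ v l * elt F Γ v' l' = 0 ∨
    (∃ t, l' = l ++ t ∧ v' = v ∧
      eltStar F Γ v l * elt F Γ v' l' = elt F Γ (Γ.endpoint v l) t) ∨
    (∃ t, l = l' ++ t ∧ v = v' ∧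
      eltStar F Γ v l * elt F Γ v' l' = eltStar F Γ (Γ.endpoint v' l') t) := by
  intro l
  induction l with
  | nil =>
    intro l' v v' _ _
    by_cases hv : v = v'
    · subst hv
      refine Or.inr (Or.inl ⟨l', rfl, rfl, ?_⟩)
      rw [eltStar_nil, elt, ← mul_assoc, vert_self, endpoint, elt]
    · left
      rw [eltStar_nil, elt, ← mul_assoc, vert_ne hv, zero_mul]
  | cons e l ih =>
    intro l' v v' h h'
    cases l' with
    | nil =>
      by_cases hv : v = v'
      · subst hv
        refine Or.inr (Or.inr ⟨e :: l, rfl, rfl, ?_⟩)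
        rw [elt_nil, eltStar, mul_assoc, vert_self, endpoint, eltStar]
      · left
        rw [elt_nil, eltStar, mul_assoc, vert_ne hv, mul_zero]
    | cons f l' =>
      obtain ⟨rfl, h⟩ := h
      obtain ⟨rfl, h'⟩ := h'
      rw [eltStar_cons, elt_cons, mul_assoc, ← mul_assoc (gen F Γ _) (gen F Γ _)]
      by_cases hef : e = f
      · subst hef
        have hv : gen F Γ (.vert (Γ.r e)) * elt F Γ (Γ.r e) l' = elt F Γ (Γ.r e) l' := by
          rw [elt, ← mul_assoc, vert_self]
        rw [ghost_edge_self, hv]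
        rcases ih h h' with h0 | ⟨t, rfl, -, h0⟩ | ⟨t, rfl, -, h0⟩
        · exact Or.inl h0
        · exact Or.inr (Or.inl ⟨t, rfl, rfl, h0⟩)
        · exact Or.inr (Or.inr ⟨t, rfl, rfl, h0⟩)
      · left
        rw [ghost_edge_ne hef, zero_mul, mul_zero]

end LPA

namespace Specialization

variable {Γ : DirGraph V E} (γ : Γ.Specialization)

/-- The product of `p q*` and `p' q'*` is `0` or of the form `x y*`, with control of the
parameters. -/
theorem mulStar_mul_mulStar (p q p' q' : Γ.Path) :
    LPA.mulStar F p q * LPA.mulStar F p' q' = 0 ∨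
    ∃ x y : Γ.Path, LPA.mulStar F p q * LPA.mulStar F p' q' = LPA.mulStar F x y ∧
      p.length + q'.length ≤ x.length + y.length ∧
      γ.sd x + γ.sd y ≤ (γ.sd p + γ.sd q) + (γ.sd p' + γ.sd q') ∧
      (x.length : ℤ) - y.length = (p.length - q.length) + (p'.length - q'.length) := by
  have key : LPA.mulStar F p q * LPA.mulStar F p' q' = LPA.elt F Γ p.src p.edges *
      (LPA.eltStar F Γ q.src q.edges * LPA.elt F Γ p'.src p'.edges) *
      LPA.eltStar F Γ q'.src q'.edges := by
    simp only [LPA.mulStar, mul_assoc]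
  rw [key]
  rcases LPA.eltStar_mul_elt (F := F) q.isWalk p'.isWalk with h | ⟨t, ht, hv, h⟩ | ⟨t, ht, hv, h⟩
  · left; rw [h, mul_zero, zero_mul]
  · rw [h]
    by_cases hpq : p.tgt = q.tgt
    · right
      have hw : Γ.IsWalk (Γ.endpoint p.src p.edges) t := by
        have := p'.isWalk
        rw [ht, hv] at this
        change Γ.IsWalk p.tgt t
        rw [hpq]; exact this.right
      refine ⟨⟨p.src, p.edges ++ t, p.isWalk.append hw⟩, q', ?_, ?_, ?_, ?_⟩
      · change Γ.endpoint p.src p.edges = Γ.endpoint q.src q.edges at hpq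
        rw [← hpq, LPA.elt_append p.isWalk, LPA.mulStar]
      · simp [Path.length]
      · have h1 := γ.sdList_append_le p.edges t
        have h2 := γ.sdList_le_append q.edges t
        simp only [sd, ht] at h1 h2 ⊢; omega
      · simp only [Path.length, ht, List.length_append]; push_cast; ring
    · left
      rw [LPA.elt_mul_elt_ne (w := Γ.endpoint q.src q.edges) p.isWalk hpq, zero_mul]
  · rw [h]
    by_cases hpq : q'.tgt = p'.tgt
    · right
      have hw : Γ.IsWalk (Γ.endpoint q'.src q'.edges) t := by
        have := q.isWalk
        rw [ht, hv] at this
        change Γ.IsWalk q'.tgt t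
        rw [hpq]; exact this.right
      refine ⟨p, ⟨q'.src, q'.edges ++ t, q'.isWalk.append hw⟩, ?_, ?_, ?_, ?_⟩
      · change Γ.endpoint q'.src q'.edges = Γ.endpoint p'.src p'.edges at hpq
        rw [← hpq, mul_assoc, LPA.eltStar_append q'.isWalk, LPA.mulStar]
      · simp [Path.length]
      · have h1 := γ.sdList_append_le q'.edges t
        have h2 := γ.sdList_le_append p'.edges t
        simp only [sd, ht] at h1 h2 ⊢; omega
      · simp only [Path.length, ht, List.length_append]; push_cast; ring
    · left
      rw [mul_assoc, LPA.eltStar_mul_eltStar_ne (w := Γ.endpoint p'.src p'.edges) q'.isWalk hpq,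
        mul_zero]

/-- `V_k` is the span of all `p q*` with `l(p) + l(q) ≥ k (sd(p) + sd(q) + |l(p) - l(q)| + 1)`. -/
theorem nbhd_eq_span {k : ℝ} (hk : 0 ≤ k) :
    γ.nbhd F k = Submodule.span F {x | ∃ p q : Γ.Path,
      k * ((γ.sd p : ℝ) + γ.sd q + |(p.length : ℝ) - q.length| + 1) ≤ (p.length : ℝ) + q.length ∧
      x = LPA.mulStar F p q} := by
  apply le_antisymm
  · refine iSup_le ?_
    rintro ⟨⟨n, s, d⟩, hn, hs, hd, h⟩
    refine Submodule.span_mono ?_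
    rintro x ⟨p, q, h1, h2, h3, rfl⟩
    refine ⟨p, q, ?_, rfl⟩
    refine le_trans ?_ (h.trans h1)
    dsimp only at h2 h3 ⊢
    gcongr
  · refine Submodule.span_le.2 ?_
    rintro x ⟨p, q, h, rfl⟩
    refine Submodule.mem_iSup_of_mem ⟨((p.length : ℝ) + q.length, (γ.sd p : ℝ) + γ.sd q,
      |(p.length : ℝ) - q.length|), by positivity, by positivity, by positivity, h⟩ ?_
    exact Submodule.subset_span ⟨p, q, le_rfl, le_rfl, le_rfl, rfl⟩

theorem nbhd_anti {k k' : ℝ} (hk : 0 ≤ k) (h : k ≤ k') : γ.nbhd F k' ≤ γ.nbhd F k := by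
  rw [nbhd_eq_span γ hk, nbhd_eq_span γ (hk.trans h)]
  refine Submodule.span_mono ?_
  rintro x ⟨p, q, h1, rfl⟩
  exact ⟨p, q, le_trans (by gcongr) h1, rfl⟩

theorem mulStar_mul_mem {k : ℝ} (hk : 0 ≤ k) (p q p' q' : Γ.Path)
    (h : k * ((γ.sd p : ℝ) + γ.sd q + |(p.length : ℝ) - q.length| + (γ.sd p' + γ.sd q' +
      |(p'.length : ℝ) - q'.length|) + 1) ≤ (p.length : ℝ) + q'.length) :
    LPA.mulStar F p q * LPA.mulStar F p' q' ∈ γ.nbhd F k := by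
  rcases γ.mulStar_mul_mulStar (F := F) p q p' q' with h0 | ⟨x, y, h0, h1, h2, h3⟩
  · rw [h0]; exact Submodule.zero_mem _
  · rw [h0, nbhd_eq_span γ hk]
    refine Submodule.subset_span ⟨x, y, ?_, rfl⟩
    have h1' : (p.length : ℝ) + q'.length ≤ (x.length : ℝ) + y.length := by exact_mod_cast h1
    have h2' : (γ.sd x : ℝ) + γ.sd y ≤ (γ.sd p + γ.sd q) + (γ.sd p' + γ.sd q') := by
      exact_mod_cast h2
    have h3' : (x.length : ℝ) - y.length = (p.length - q.length) + (p'.length - q'.length) := by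
      exact_mod_cast h3
    have h4 : |(x.length : ℝ) - y.length| ≤
        |(p.length : ℝ) - q.length| + |(p'.length : ℝ) - q'.length| := by
      rw [h3']; exact abs_add_le _ _
    refine le_trans ?_ (h.trans h1')
    refine mul_le_mul_of_nonneg_left ?_ hk
    linarith

theorem nbhd_mul {k : ℝ} (hk : 0 ≤ k) {a b : LPA F Γ} (ha : a ∈ γ.nbhd F (2 * k + 1))
    (hb : b ∈ γ.nbhd F (2 * k + 1)) : a * b ∈ γ.nbhd F k := by
  rw [nbhd_eq_span γ (by positivity)] at ha hb
  have := Submodule.mul_mem_mul ha hb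
  rw [Submodule.span_mul_span] at this
  refine (Submodule.span_le.2 ?_ : _ ≤ γ.nbhd F k) this
  rintro _ ⟨_, ⟨p, q, h1, rfl⟩, _, ⟨p', q', h2, rfl⟩, rfl⟩
  refine γ.mulStar_mul_mem hk p q p' q' ?_
  have := le_abs_self ((p.length : ℝ) - q.length)
  have := neg_abs_le ((p.length : ℝ) - q.length)
  have := le_abs_self ((p'.length : ℝ) - q'.length)
  have := neg_abs_le ((p'.length : ℝ) - q'.length)
  have hs : (0 : ℝ) ≤ γ.sd p + γ.sd q + (γ.sd p' + γ.sd q') := by positivity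
  linarith

theorem mem_span_mulStar (γ : Γ.Specialization) (a : LPA F Γ) :
    a ∈ Submodule.span F {x | ∃ p q : Γ.Path, x = LPA.mulStar F p q} := by
  classical
  set S := Submodule.span F {x | ∃ p q : Γ.Path, x = LPA.mulStar F p q} with hS
  have hone : (1 : LPA F Γ) ∈ S := by
    rw [← LPA.sum_vert]
    refine Submodule.sum_mem _ fun v _ => Submodule.subset_span
      ⟨⟨v, [], trivial⟩, ⟨v, [], trivial⟩, ?_⟩
    simp only [LPA.mulStar, LPA.elt_nil, LPA.eltStar_nil, LPA.vert_self]
  have hmul : ∀ a ∈ S, ∀ b ∈ S, a * b ∈ S := by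
    intro a ha b hb
    have := Submodule.mul_mem_mul ha hb
    rw [hS, Submodule.span_mul_span] at this
    refine (Submodule.span_le.2 ?_ : _ ≤ S) this
    rintro _ ⟨_, ⟨p, q, rfl⟩, _, ⟨p', q', rfl⟩, rfl⟩
    change LPA.mulStar F p q * LPA.mulStar F p' q' ∈ S
    rcases γ.mulStar_mul_mulStar (F := F) p q p' q' with h0 | ⟨x, y, h0, -⟩
    · rw [h0]; exact S.zero_mem
    · rw [h0]; exact Submodule.subset_span ⟨x, y, rfl⟩
  obtain ⟨x, rfl⟩ := LPA.proj_surjective (F := F) a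
  induction x using FreeAlgebra.induction with
  | grade0 c =>
    rw [AlgHom.commutes, Algebra.algebraMap_eq_smul_one]
    exact S.smul_mem _ hone
  | grade1 g =>
    change LPA.gen F Γ g ∈ S
    cases g with
    | vert v =>
      refine Submodule.subset_span ⟨⟨v, [], trivial⟩, ⟨v, [], trivial⟩, ?_⟩
      simp only [LPA.mulStar, LPA.elt_nil, LPA.eltStar_nil, LPA.vert_self]
    | edge e =>
      refine Submodule.subset_span ⟨⟨Γ.s e, [e], rfl, trivial⟩, ⟨Γ.r e, [], trivial⟩, ?_⟩
      simp only [LPA.mulStar, LPA.elt_cons, LPA.elt_nil, LPA.eltStar_nil, LPA.edge_range]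
    | ghost e =>
      refine Submodule.subset_span ⟨⟨Γ.r e, [], trivial⟩, ⟨Γ.s e, [e], rfl, trivial⟩, ?_⟩
      simp only [LPA.mulStar, LPA.eltStar_cons, LPA.elt_nil, LPA.eltStar_nil, LPA.range_ghost]
  | mul a b ha hb => rw [map_mul]; exact hmul _ ha _ hb
  | add a b ha hb => rw [map_add]; exact S.add_mem ha hb

theorem exists_mul_mem (a : LPA F Γ) : ∀ k : ℝ, 0 ≤ k → ∃ k' : ℝ, 0 ≤ k' ∧
    ∀ b ∈ γ.nbhd F k', a * b ∈ γ.nbhd F k ∧ b * a ∈ γ.nbhd F k := by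
  have ha := γ.mem_span_mulStar a
  induction ha using Submodule.span_induction with
  | zero => exact fun k hk => ⟨k, hk, fun b _ => by simp⟩
  | add x y _ _ hx hy =>
    intro k hk
    obtain ⟨k₁, h1, hx⟩ := hx k hk
    obtain ⟨k₂, h2, hy⟩ := hy k hk
    refine ⟨max k₁ k₂, h1.trans (le_max_left _ _), fun b hb => ?_⟩
    have hb1 := hx b (γ.nbhd_anti h1 (le_max_left _ _) hb)
    have hb2 := hy b (γ.nbhd_anti h2 (le_max_right _ _) hb)
    rw [add_mul, mul_add]
    exact ⟨Submodule.add_mem _ hb1.1 hb2.1, Submodule.add_mem _ hb1.2 hb2.2⟩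
  | smul c x _ hx =>
    intro k hk
    obtain ⟨k', h', hx⟩ := hx k hk
    refine ⟨k', h', fun b hb => ?_⟩
    rw [smul_mul_assoc, mul_smul_comm]
    exact ⟨Submodule.smul_mem _ _ (hx b hb).1, Submodule.smul_mem _ _ (hx b hb).2⟩
  | mem x hx =>
    obtain ⟨p, q, rfl⟩ := hx
    intro k hk
    have hA : (0 : ℝ) ≤ (γ.sd p : ℝ) + γ.sd q + |(p.length : ℝ) - q.length| := by positivity
    set A : ℝ := (γ.sd p : ℝ) + γ.sd q + |(p.length : ℝ) - q.length| with hAdef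
    have hk' : 0 ≤ 2 * (k * (A + 1)) + 1 := by positivity
    have est : ∀ p' q' : Γ.Path, (2 * (k * (A + 1)) + 1) *
        ((γ.sd p' : ℝ) + γ.sd q' + |(p'.length : ℝ) - q'.length| + 1) ≤
          (p'.length : ℝ) + q'.length →
        k * (A + ((γ.sd p' : ℝ) + γ.sd q' + |(p'.length : ℝ) - q'.length|) + 1) ≤ p'.length ∧
        k * (A + ((γ.sd p' : ℝ) + γ.sd q' + |(p'.length : ℝ) - q'.length|) + 1) ≤ q'.length := by
      intro p' q' h
      have hs : (0 : ℝ) ≤ (γ.sd p' : ℝ) + γ.sd q' := by positivity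
      have hd : (0 : ℝ) ≤ |(p'.length : ℝ) - q'.length| := abs_nonneg _
      have h1 := le_abs_self ((p'.length : ℝ) - q'.length)
      have h2 := neg_abs_le ((p'.length : ℝ) - q'.length)
      have hT := mul_nonneg (mul_nonneg hk hA) (add_nonneg hs hd)
      constructor <;> nlinarith
    refine ⟨_, hk', fun b hb => ?_⟩
    rw [nbhd_eq_span γ hk'] at hb
    induction hb using Submodule.span_induction with
    | zero => simp
    | add x y _ _ hx hy =>
      rw [add_mul, mul_add]
      exact ⟨Submodule.add_mem _ hx.1 hy.1, Submodule.add_mem _ hx.2 hy.2⟩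
    | smul c x _ hx =>
      rw [smul_mul_assoc, mul_smul_comm]
      exact ⟨Submodule.smul_mem _ _ hx.1, Submodule.smul_mem _ _ hx.2⟩
    | mem x hx =>
      obtain ⟨p', q', h, rfl⟩ := hx
      obtain ⟨h1, h2⟩ := est p' q' h
      have hp : (0 : ℝ) ≤ p.length := by positivity
      have hq : (0 : ℝ) ≤ q.length := by positivity
      refine ⟨γ.mulStar_mul_mem hk _ _ _ _ ?_, γ.mulStar_mul_mem hk _ _ _ _ ?_⟩
      · rw [← hAdef]; linarith
      · rw [← hAdef, add_comm _ A]; linarith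

/-! ### The completion -/

variable (F)

/-- The algebra `L(Γ)`, equipped below with the topology determined by the specialization `γ`. -/
def TopLPA (_ : Γ.Specialization) : Type _ := LPA F Γ

noncomputable instance : Ring (γ.TopLPA F) := inferInstanceAs (Ring (LPA F Γ))

noncomputable instance : Algebra F (γ.TopLPA F) := inferInstanceAs (Algebra F (LPA F Γ))

/-- The identity map from `L(Γ)` to its topologized copy. -/
noncomputable def toTop : LPA F Γ ≃ₐ[F] γ.TopLPA F := AlgEquiv.refl

/-- The subspaces `V_1 ⊇ V_2 ⊇ ⋯`, as additive subgroups; `V_{k+1}` has the index `k : ℕ`. -/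
noncomputable def basisSubgroup (k : ℕ) : AddSubgroup (γ.TopLPA F) :=
  ((γ.nbhd F (k + 1)).map (γ.toTop F).toLinearMap).toAddSubgroup

theorem mem_basisSubgroup {k : ℕ} {a : γ.TopLPA F} :
    a ∈ γ.basisSubgroup F k ↔ (γ.toTop F).symm a ∈ γ.nbhd F (k + 1) :=
  ⟨fun ⟨_, hb, h⟩ => h ▸ hb, fun h => ⟨_, h, rfl⟩⟩

theorem ringSubgroupsBasis : RingSubgroupsBasis (γ.basisSubgroup F) where
  inter i j := ⟨max i j, fun a ha => by
    rw [mem_basisSubgroup] at ha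
    have hi : ((i : ℝ) + 1) ≤ ((max i j : ℕ) : ℝ) + 1 := by
      have : (i : ℝ) ≤ ((max i j : ℕ) : ℝ) := by exact_mod_cast le_max_left i j
      linarith
    have hj : ((j : ℝ) + 1) ≤ ((max i j : ℕ) : ℝ) + 1 := by
      have : (j : ℝ) ≤ ((max i j : ℕ) : ℝ) := by exact_mod_cast le_max_right i j
      linarith
    exact ⟨(γ.mem_basisSubgroup F).2 (γ.nbhd_anti (by positivity) hi ha),
      (γ.mem_basisSubgroup F).2 (γ.nbhd_anti (by positivity) hj ha)⟩⟩
  mul i := ⟨2 * i + 2, by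
    rintro _ ⟨a, ha, b, hb, rfl⟩
    rw [SetLike.mem_coe, mem_basisSubgroup] at ha hb ⊢
    have h : (((2 * i + 2 : ℕ) : ℝ) + 1) = 2 * ((i : ℝ) + 1) + 1 := by push_cast; ring
    rw [h] at ha hb
    change (γ.toTop F).symm (a * b) ∈ _
    rw [map_mul]
    exact γ.nbhd_mul (by positivity) ha hb⟩
  leftMul x i := by
    obtain ⟨k, hk, h⟩ := γ.exists_mul_mem ((γ.toTop F).symm x) (i + 1) (by positivity)
    obtain ⟨n, hn⟩ := exists_nat_ge k
    refine ⟨n, fun a ha => ?_⟩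
    rw [SetLike.mem_coe, mem_basisSubgroup] at ha
    rw [Set.mem_preimage, SetLike.mem_coe, mem_basisSubgroup, map_mul]
    exact (h _ (γ.nbhd_anti hk (by linarith) ha)).1
  rightMul x i := by
    obtain ⟨k, hk, h⟩ := γ.exists_mul_mem ((γ.toTop F).symm x) (i + 1) (by positivity)
    obtain ⟨n, hn⟩ := exists_nat_ge k
    refine ⟨n, fun a ha => ?_⟩
    rw [SetLike.mem_coe, mem_basisSubgroup] at ha
    rw [Set.mem_preimage, SetLike.mem_coe, mem_basisSubgroup, map_mul]
    exact (h _ (γ.nbhd_anti hk (by linarith) ha)).2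

/-- The topology on `L(Γ)` for which the `V_k`, `k ≥ 1`, form a basis of neighborhoods of `0`. -/
noncomputable instance : TopologicalSpace (γ.TopLPA F) := (γ.ringSubgroupsBasis F).topology

instance : IsTopologicalRing (γ.TopLPA F) :=
  (γ.ringSubgroupsBasis F).toRingFilterBasis.isTopologicalRing

noncomputable instance : UniformSpace (γ.TopLPA F) :=
  IsTopologicalAddGroup.rightUniformSpace (γ.TopLPA F)

instance : IsUniformAddGroup (γ.TopLPA F) := isUniformAddGroup_of_addCommGroup

instance : UniformContinuousConstSMul F (γ.TopLPA F) :=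
  have : ContinuousConstSMul F (γ.TopLPA F) := ⟨fun c => by
    simp only [Algebra.smul_def]; exact continuous_const_mul _⟩
  uniformContinuousConstSMul_of_continuousConstSMul _ _

/-- The completion of the topological algebra `L(Γ)`. -/
abbrev FullCompletion : Type _ := UniformSpace.Completion (γ.TopLPA F)

/-- The canonical map from `L(Γ)` to its completion. -/
noncomputable def toFull : LPA F Γ →ₐ[F] γ.FullCompletion F :=
  AlgHom.comp { UniformSpace.Completion.coeRingHom (α := γ.TopLPA F) with
    commutes' := fun _ => rfl } (γ.toTop F).toAlgHom

/-- The completion of `L(Γ)_i`: the closure of its image in the completion of `L(Γ)`. -/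
noncomputable def homogClosure (i : ℤ) : Submodule F (γ.FullCompletion F) :=
  ((LPA.homog F Γ i).map (γ.toFull F).toLinearMap).topologicalClosure

theorem homogClosure_mul {i j : ℤ} {a b : γ.FullCompletion F} (ha : a ∈ γ.homogClosure F i)
    (hb : b ∈ γ.homogClosure F j) : a * b ∈ γ.homogClosure F (i + j) := by
  refine map_mem_closure₂ (f := fun a b => a * b) continuous_mul ha hb ?_
  rintro _ ⟨x, hx, rfl⟩ _ ⟨y, hy, rfl⟩
  refine ⟨x * y, ?_, map_mul (γ.toFull F) x y⟩
  have := Submodule.mul_mem_mul hx hy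
  rw [LPA.homog, LPA.homog, Submodule.span_mul_span] at this
  refine (Submodule.span_mono ?_ : _ ≤ LPA.homog F Γ (i + j)) this
  rintro _ ⟨_, ⟨l, rfl, rfl⟩, _, ⟨m, rfl, rfl⟩, rfl⟩
  exact ⟨l ++ m, by simp, by simp⟩

theorem toFull_mem_homogClosure (l : List (Gen V E)) :
    γ.toFull F (l.map (LPA.gen F Γ)).prod ∈ γ.homogClosure F (l.map Gen.deg).sum :=
  Submodule.le_topologicalClosure _ ⟨_, Submodule.subset_span ⟨l, rfl, rfl⟩, rfl⟩

/-- The graded completion: the sum over `i : ℤ` of the completions of the `L(Γ)_i`, a subalgebra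
of the completion of `L(Γ)`. It carries the subspace topology. -/
noncomputable def LHat : Subalgebra F (γ.FullCompletion F) :=
  (⨆ i : ℤ, γ.homogClosure F i).toSubalgebra
    (by
      have := γ.toFull_mem_homogClosure F []
      rw [List.map_nil (f := LPA.gen F Γ), List.prod_nil, map_one] at this
      exact Submodule.mem_iSup_of_mem _ this)
    (by
      intro a b ha hb
      induction ha using Submodule.iSup_induction' with
      | zero => rw [zero_mul]; exact Submodule.zero_mem _
      | add x y _ _ hx hy => rw [add_mul]; exact Submodule.add_mem _ hx hy
      | mem i x hx =>
        induction hb using Submodule.iSup_induction' with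
        | zero => rw [mul_zero]; exact Submodule.zero_mem _
        | add y z _ _ hy hz => rw [mul_add]; exact Submodule.add_mem _ hy hz
        | mem j y hy => exact Submodule.mem_iSup_of_mem _ (γ.homogClosure_mul F hx hy))

theorem toFull_mem_LHat (a : LPA F Γ) : γ.toFull F a ∈ γ.LHat F := by
  obtain ⟨x, rfl⟩ := LPA.proj_surjective (F := F) a
  induction x using FreeAlgebra.induction with
  | grade0 c =>
    rw [AlgHom.commutes, AlgHom.commutes]
    exact Subalgebra.algebraMap_mem _ _
  | grade1 g =>
    have := γ.toFull_mem_homogClosure F [g]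
    rw [List.map_singleton (f := LPA.gen F Γ), List.prod_singleton] at this
    exact Submodule.mem_iSup_of_mem (p := fun i => γ.homogClosure F i) _ this
  | mul a b ha hb => rw [map_mul, map_mul]; exact mul_mem ha hb
  | add a b ha hb => rw [map_add, map_add]; exact add_mem ha hb

/-- The canonical map from `L(Γ)` to the graded completion. -/
noncomputable def toLHat : LPA F Γ →ₐ[F] γ.LHat F :=
  (γ.toFull F).codRestrict (γ.LHat F) (γ.toFull_mem_LHat F)

/-- The element `p p*` of the graded completion. -/
noncomputable def proj (p : Γ.Path) : γ.LHat F := γ.toLHat F (LPA.mulStar F p p)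

/-- `e(W)`: the sum of all `p p*`, where `p` is an arrival path in `W`; `e(∅) = 0`. -/
noncomputable def idem (W : Set V) : γ.LHat F := ∑' p : Γ.arr W, γ.proj F p

/-- `I(W)`: the closed two-sided ideal of the graded completion that is generated by `W`, i.e. the
smallest one that contains all vertices of `W`. -/
noncomputable def ideal (W : Set V) : TwoSidedIdeal (γ.LHat F) :=
  sInf {I | IsClosed (I : Set (γ.LHat F)) ∧ ∀ w ∈ W, γ.toLHat F (LPA.gen F Γ (.vert w)) ∈ I}

end Specialization

end Algebra

end DirGraph

/-!
A path that arrives in a hereditary set `W` leaves no vertex of the frame: a minimal hereditary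
set that meets `W` is contained in `W`. By the standing assumption on the specialization, `sd` is
bounded on the paths that leave no vertex of the frame (`IsAdmissible.exists_sd_le`), so for these
`p p*`, which has degree `0`, tends to `0` as the length of `p` grows. Hence `e(W)` converges
(`IsAdmissible.summable_proj`).

It commutes with the vertices and the edges, by comparing terms, and with the ghost edges, as
`e* x = ∑ e* f x f*`; since `L(Γ)` is dense, `e(W)` is central (`IsAdmissible.idem_commute`). As
the only arrival path from `w ∈ W` is `w` itself, `w e(W) = w`; this makes `e(W)` idempotent and
gives `I(W) = {x | e(W) x = x}` (`IsAdmissible.mem_ideal_iff`).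

The comparison of `e(W')` and `e(W)` for `W' ⊆ W` rests on
`IsAdmissible.vert_mul_idem_of_isDescendant`: if every vertex of `W` has a descendant in `W'`, then
`v e(W') = v` for all `v ∈ W`. Indeed `x = 1 - e(W')` is central and annihilates `W'`, and
expanding `v = ∑ e e*` repeatedly shows `v x = y x`, where `y` is a combination of elements `p p*`
with `p` of any prescribed length and leaving no vertex of the frame; thus `v x = 0`. In
particular `e(W) = 1` if every vertex has a descendant in `W`. Together with additivity and
orthogonality for disjoint sets, applied to `W ∪ W^⊥` and to the union of the frame, this yields
the direct sum decompositions.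

Everything before the theorem is stated for sets closed under descendants, the empty set included.
-/

namespace DirGraph

variable {V E : Type*}

/-! ### Descendants and the frame -/

section Graph

variable {Γ : DirGraph V E}

/-- A possibly empty set of vertices that is closed under taking descendants; the nonempty ones
are the hereditary sets. Allowing the empty set covers `W^⊥` without a case distinction. -/
def DescClosed (Γ : DirGraph V E) (W : Set V) : Prop :=
  ∀ w ∈ W, ∀ u, Γ.IsDescendant w u → u ∈ W

theorem IsHereditary.descClosed {W : Set V} (h : Γ.IsHereditary W) : Γ.DescClosed W := h.2

theorem endpoint_append (l t : List E) : ∀ v : V,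
    Γ.endpoint v (l ++ t) = Γ.endpoint (Γ.endpoint v l) t := by
  induction l with
  | nil => intro v; rfl
  | cons e l ih => intro v; exact ih _

theorem IsDescendant.refl (v : V) : Γ.IsDescendant v v := ⟨⟨v, [], trivial⟩, rfl, rfl⟩

theorem IsDescendant.trans {u v w : V} (h : Γ.IsDescendant u v) (h' : Γ.IsDescendant v w) :
    Γ.IsDescendant u w := by
  obtain ⟨p, rfl, rfl⟩ := h
  obtain ⟨q, hq, rfl⟩ := h'
  have hw : Γ.IsWalk (Γ.endpoint p.src p.edges) q.edges := by
    have := q.isWalk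
    rwa [hq] at this
  refine ⟨⟨p.src, p.edges ++ q.edges, p.isWalk.append hw⟩, rfl, ?_⟩
  change Γ.endpoint _ _ = Γ.endpoint _ _
  rw [endpoint_append, hq]
  rfl

theorem IsDescendant.edge (e : E) : Γ.IsDescendant (Γ.s e) (Γ.r e) :=
  ⟨⟨Γ.s e, [e], rfl, trivial⟩, rfl, rfl⟩

theorem IsWalk.isDescendant_source {l : List E} : ∀ {v : V}, Γ.IsWalk v l → ∀ e ∈ l,
    Γ.IsDescendant v (Γ.s e) ∧ Γ.IsDescendant (Γ.s e) (Γ.endpoint v l) := by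
  induction l with
  | nil => intro v _ e he; simp at he
  | cons f l ih =>
    rintro v ⟨rfl, h⟩ e he
    rcases List.mem_cons.1 he with rfl | he
    · exact ⟨.refl _, ⟨⟨Γ.s e, e :: l, rfl, h⟩, rfl, rfl⟩⟩
    · exact ⟨(IsDescendant.edge f).trans (ih h e he).1, (ih h e he).2⟩

theorem Path.isDescendant (p : Γ.Path) : Γ.IsDescendant p.src p.tgt := ⟨p, rfl, rfl⟩

theorem descClosed_univ : Γ.DescClosed Set.univ := fun _ _ _ _ => trivial

theorem DescClosed.union {W W' : Set V} (h : Γ.DescClosed W) (h' : Γ.DescClosed W') :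
    Γ.DescClosed (W ∪ W') := fun w hw u hu =>
  hw.imp (fun hw => h w hw u hu) (fun hw => h' w hw u hu)

theorem descClosed_sUnion {S : Set (Set V)} (h : ∀ W ∈ S, Γ.DescClosed W) :
    Γ.DescClosed (⋃₀ S) := fun w ⟨W, hW, hw⟩ u hu => ⟨W, hW, h W hW w hw u hu⟩

theorem descClosed_perp (W : Set V) : Γ.DescClosed (Γ.perp W) :=
  fun _ hv _ hu w hw hd => hv w hw (hu.trans hd)

theorem disjoint_perp {W : Set V} : Disjoint W (Γ.perp W) :=
  Set.disjoint_left.2 fun w hw h => h w hw (.refl w)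

theorem DescClosed.subset_perp_perp {W : Set V} (h : Γ.DescClosed W) :
    W ⊆ Γ.perp (Γ.perp W) :=
  fun w hw _ hu hd => hu _ (h w hw _ hd) (.refl _)

theorem exists_isDescendant_of_notMem_perp {W : Set V} {v : V} (h : v ∉ Γ.perp W) :
    ∃ w ∈ W, Γ.IsDescendant v w := by
  simpa [perp] using h

theorem DescClosed.frame_subset {W M : Set V} (h : Γ.DescClosed W) (hM : M ∈ Γ.frame)
    (hne : (M ∩ W).Nonempty) : M ⊆ W := by
  have hM' : Minimal Γ.IsHereditary M := hM
  have : M ≤ M ∩ W := hM'.le_of_le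
    ⟨hne, fun w hw u hu => ⟨hM'.prop.2 w hw.1 u hu, h w hw.2 u hu⟩⟩ Set.inter_subset_left
  exact fun x hx => (this hx).2

theorem frame_disjoint {M M' : Set V} (hM : M ∈ Γ.frame) (hM' : M' ∈ Γ.frame) (h : M ≠ M') :
    Disjoint M M' := by
  rw [Set.disjoint_iff_inter_eq_empty]
  by_contra hne
  have hne := Set.nonempty_iff_ne_empty.2 hne
  exact h ((DescClosed.frame_subset hM'.prop.2 hM hne).antisymm
    (DescClosed.frame_subset hM.prop.2 hM' (by rwa [Set.inter_comm])))

/-- A vertex of the frame that has a descendant in `W` lies in `W`. -/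
theorem DescClosed.notMem_frame {W : Set V} (h : Γ.DescClosed W) {v w : V} (hv : v ∉ W)
    (hw : w ∈ W) (hd : Γ.IsDescendant v w) : v ∉ ⋃₀ Γ.frame := by
  rintro ⟨M, hM, hvM⟩
  exact hv (h.frame_subset hM ⟨w, hM.prop.2 v hvM w hd, hw⟩ hvM)

theorem descClosed_of_mem_frame {M : Set V} (hM : M ∈ Γ.frame) : Γ.DescClosed M :=
  IsHereditary.descClosed (Minimal.prop hM)

theorem exists_isDescendant_frame [Finite V] (v : V) :
    ∃ w ∈ ⋃₀ Γ.frame, Γ.IsDescendant v w := by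
  have hv : {u | Γ.IsDescendant v u} ∈ {W | Γ.IsHereditary W} :=
    ⟨⟨v, .refl v⟩, fun w hw u hu => IsDescendant.trans hw hu⟩
  obtain ⟨M, hle, hM⟩ := (Set.toFinite {W | Γ.IsHereditary W}).exists_le_minimal hv
  obtain ⟨w, hw⟩ := hM.prop.1
  exact ⟨w, ⟨M, hM, hw⟩, hle hw⟩

theorem DescClosed.arr_notMem_frame {W : Set V} (h : Γ.DescClosed W) {p : Γ.Path}
    (hp : p ∈ Γ.arr W) : ∀ e ∈ p.edges, Γ.s e ∉ ⋃₀ Γ.frame := fun e he =>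
  h.notMem_frame (hp.2 e he) hp.1 (p.isWalk.isDescendant_source e he).2

theorem edges_eq_nil_of_mem_arr {W : Set V} {p : Γ.Path} (hp : p ∈ Γ.arr W) (h : p.src ∈ W) :
    p.edges = [] := by
  rcases p with ⟨v, _ | ⟨e, l⟩, hl⟩
  · rfl
  · exact absurd (hl.1 ▸ h : Γ.s e ∈ W) (hp.2 e List.mem_cons_self)

theorem arr_union_of_disjoint {W W' : Set V} (hW' : Γ.DescClosed W')
    (hW : Γ.DescClosed W) (h : Disjoint W W') : Γ.arr (W ∪ W') = Γ.arr W ∪ Γ.arr W' := by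
  have key : ∀ p : Γ.Path, ∀ e ∈ p.edges, Γ.IsDescendant (Γ.s e) p.tgt :=
    fun p e he => (p.isWalk.isDescendant_source e he).2
  have hd := Set.disjoint_left.1 h
  ext p
  constructor
  · rintro ⟨hp | hp, hs⟩
    · exact Or.inl ⟨hp, fun e he h => hs e he (Or.inl h)⟩
    · exact Or.inr ⟨hp, fun e he h => hs e he (Or.inr h)⟩
  · rintro (⟨hp, hs⟩ | ⟨hp, hs⟩)
    · refine ⟨Or.inl hp, fun e he h => h.elim (hs e he) fun h => ?_⟩
      exact hd hp (hW' _ h _ (key p e he))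
    · refine ⟨Or.inr hp, fun e he h => h.elim (fun h => ?_) (hs e he)⟩
      exact hd (hW _ h _ (key p e he)) hp

/-- The map `p ↦ e p` from the arrival paths that start at `r(e)` to the arrival paths, for an
edge `e` with source outside of `W`. -/
def arrCons {W : Set V} {e : E} (he : Γ.s e ∉ W) (p : {p : Γ.arr W // p.1.src = Γ.r e}) :
    Γ.arr W :=
  ⟨⟨Γ.s e, e :: p.1.1.edges, rfl, by have := p.1.1.isWalk; rwa [p.2] at this⟩, by
    have : Γ.endpoint p.1.1.src p.1.1.edges ∈ W := p.1.2.1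
    rwa [p.2] at this, by
    rintro f hf
    rcases List.mem_cons.1 hf with rfl | hf
    exacts [he, p.1.2.2 f hf]⟩

theorem arrCons_injective {W : Set V} {e : E} (he : Γ.s e ∉ W) :
    Function.Injective (arrCons he) := by
  intro p q h
  have h1 : e :: p.1.1.edges = e :: q.1.1.edges := congrArg (fun x => x.1.edges) h
  exact Subtype.ext (Subtype.ext (Path.ext (p.2.trans q.2.symm) (List.cons.inj h1).2))

theorem finite_setOf_length_lt [Finite V] [Finite E] (N : ℕ) :
    {p : Γ.Path | p.length < N}.Finite := by
  have : ({p : Γ.Path | p.length < N}.image fun p => (p.src, p.edges)).Finite := by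
    refine ((Set.finite_univ (α := V)).prod (List.finite_length_lt E N)).subset ?_
    rintro _ ⟨p, hp, rfl⟩
    exact ⟨trivial, hp⟩
  refine this.of_finite_image fun p _ q _ h => ?_
  exact Path.ext (congrArg Prod.fst h) (congrArg Prod.snd h)

/-- The standing assumption bounds `sd p` for the paths `p` that leave no vertex of the frame: the
longest special final segment is again such a path. -/
theorem Specialization.IsAdmissible.exists_sd_le {γ : Γ.Specialization} (hγ : γ.IsAdmissible) :
    ∃ C : ℕ, ∀ p : Γ.Path, (∀ e ∈ p.edges, Γ.s e ∉ ⋃₀ Γ.frame) → γ.sd p ≤ C := by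
  classical
  obtain ⟨C, hC⟩ := (hγ.image Path.length).bddAbove
  refine ⟨C, fun p hp => ?_⟩
  set t := p.edges.rtakeWhile fun e => decide (γ.IsSpecial e) with ht
  have hsd : γ.sd p = t.length := by
    simp only [sd, sdList, ht]
  rw [hsd]
  by_cases h0 : t = []
  · simp [h0]
  have hlt : (p.edges.rdropWhile fun e => decide (γ.IsSpecial e)) ++ t = p.edges :=
    List.rdropWhile_append_rtakeWhile
  have hw := p.isWalk
  rw [← hlt] at hw
  refine hC ⟨⟨_, t, hw.right⟩, ⟨⟨h0, fun e he => ?_⟩, fun e he => hp e ?_⟩, rfl⟩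
  · simpa using List.mem_rtakeWhile_imp he
  · rw [← hlt]
    exact List.mem_append_right _ he

end Graph

/-! ### The projections `p p*` -/

section LeavittPathAlgebra

variable [Fintype V] [Fintype E] {F : Type*} [Field F] {Γ : DirGraph V E}

namespace LPA

open Classical in
theorem vert_eq_sum {v : V} (h : ¬ Γ.IsSink v) : gen F Γ (.vert v) =
    ∑ e with Γ.s e = v, gen F Γ (.edge e) * gen F Γ (.ghost e) := by
  have := proj_rel (Rel.vert_eq_sum (F := F) (Γ := Γ) v h)
  rw [map_sum] at this
  simp only [map_mul] at this
  exact this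

theorem vert_mul_elt (v : V) (l : List E) : gen F Γ (.vert v) * elt F Γ v l = elt F Γ v l := by
  rw [elt, ← mul_assoc, vert_self]

theorem vert_mul_elt_ne {v w : V} (h : v ≠ w) (l : List E) :
    gen F Γ (.vert v) * elt F Γ w l = 0 := by
  rw [elt, ← mul_assoc, vert_ne h, zero_mul]

theorem eltStar_mul_vert (v : V) (l : List E) :
    eltStar F Γ v l * gen F Γ (.vert v) = eltStar F Γ v l := by
  rw [eltStar, mul_assoc, vert_self]

theorem eltStar_mul_vert_ne {v w : V} (h : v ≠ w) (l : List E) :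
    eltStar F Γ v l * gen F Γ (.vert w) = 0 := by
  rw [eltStar, mul_assoc, vert_ne h, mul_zero]

theorem elt_mul_vert_tgt (p : Γ.Path) :
    elt F Γ p.src p.edges * gen F Γ (.vert p.tgt) = elt F Γ p.src p.edges := by
  have := elt_append (F := F) (t := []) p.isWalk
  rwa [List.append_nil, elt_nil] at this

theorem mulStar_nil (v : V) (h : Γ.IsWalk v []) :
    mulStar F (⟨v, [], h⟩ : Γ.Path) ⟨v, [], h⟩ = gen F Γ (.vert v) := by
  rw [mulStar, elt_nil, eltStar_nil, vert_self]

/-- The projection of the path `e p` is `e (p p*) e*`. -/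
theorem mulStar_cons (e : E) (l : List E) (h : Γ.IsWalk (Γ.r e) l) :
    mulStar F (⟨Γ.s e, e :: l, rfl, h⟩ : Γ.Path) ⟨Γ.s e, e :: l, rfl, h⟩ =
      gen F Γ (.edge e) * mulStar F (⟨Γ.r e, l, h⟩ : Γ.Path) ⟨Γ.r e, l, h⟩ *
        gen F Γ (.ghost e) := by
  simp only [mulStar, elt_cons, eltStar_cons, mul_assoc]

theorem vert_mul_mulStar (p : Γ.Path) :
    gen F Γ (.vert p.src) * mulStar F p p = mulStar F p p := by
  rw [mulStar, ← mul_assoc, vert_mul_elt]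

theorem vert_mul_mulStar_ne {v : V} {p : Γ.Path} (h : v ≠ p.src) :
    gen F Γ (.vert v) * mulStar F p p = 0 := by
  rw [mulStar, ← mul_assoc, vert_mul_elt_ne h, zero_mul]

theorem mulStar_mul_vert (p : Γ.Path) :
    mulStar F p p * gen F Γ (.vert p.src) = mulStar F p p := by
  rw [mulStar, mul_assoc, eltStar_mul_vert]

theorem mulStar_mul_vert_ne {v : V} {p : Γ.Path} (h : p.src ≠ v) :
    mulStar F p p * gen F Γ (.vert v) = 0 := by
  rw [mulStar, mul_assoc, eltStar_mul_vert_ne h, mul_zero]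

theorem vert_commute_mulStar (v : V) (p : Γ.Path) :
    Commute (gen F Γ (.vert v)) (mulStar F p p) := by
  rcases eq_or_ne v p.src with rfl | h
  · exact (vert_mul_mulStar p).trans (mulStar_mul_vert p).symm
  · exact (vert_mul_mulStar_ne h).trans (mulStar_mul_vert_ne h.symm).symm

theorem vert_mul_edge_ne {e : E} {v : V} (h : v ≠ Γ.s e) :
    gen F Γ (.vert v) * gen F Γ (.edge e) = 0 := by
  rw [← source_edge, ← mul_assoc, vert_ne h, zero_mul]

/-- `L(Γ)` is generated by the vertices, edges and ghost edges. -/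
theorem induction_gen {P : LPA F Γ → Prop} (a : LPA F Γ) (algebraMap : ∀ c, P (algebraMap F _ c))
    (gen : ∀ x, P (gen F Γ x)) (add : ∀ a b, P a → P b → P (a + b))
    (mul : ∀ a b, P a → P b → P (a * b)) : P a := by
  obtain ⟨x, rfl⟩ := proj_surjective (F := F) a
  induction x using FreeAlgebra.induction with
  | grade0 c => rw [AlgHom.commutes]; exact algebraMap c
  | grade1 g => exact gen g
  | mul a b ha hb => rw [map_mul]; exact mul _ _ ha hb
  | add a b ha hb => rw [map_add]; exact add _ _ ha hb

end LPA

end LeavittPathAlgebra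

/-! ### Convergence of the sums `e(W)` -/

section Topology

variable [Fintype V] [Fintype E] {F : Type*} [Field F] {Γ : DirGraph V E}

namespace Specialization

variable (γ : Γ.Specialization)

theorem exists_forall_mem_of_mem_nhds {U : Set (γ.FullCompletion F)} (hU : U ∈ nhds 0) :
    ∃ k : ℕ, ∀ a ∈ γ.nbhd F (k + 1), γ.toFull F a ∈ U := by
  have hc : Continuous ((↑) : γ.TopLPA F → γ.FullCompletion F) :=
    UniformSpace.Completion.continuous_coe _
  have h0 : ((↑) : γ.TopLPA F → γ.FullCompletion F) ⁻¹' U ∈ nhds (0 : γ.TopLPA F) :=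
    hc.continuousAt.preimage_mem_nhds (by rwa [UniformSpace.Completion.coe_zero])
  obtain ⟨k, -, hk⟩ := (γ.ringSubgroupsBasis F).hasBasis_nhds_zero.mem_iff.1 h0
  exact ⟨k, fun a ha => hk ((γ.mem_basisSubgroup F (a := γ.toTop F a)).2 ha)⟩

variable {γ}

/-- For the paths `p` that leave no vertex of the frame, `p p*` tends to `0` with growing
length, because `sd p` is bounded and `p p*` has degree `0`. -/
theorem IsAdmissible.exists_mulStar_mem (hγ : γ.IsAdmissible) (k : ℕ) : ∃ N : ℕ, ∀ p : Γ.Path,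
    (∀ e ∈ p.edges, Γ.s e ∉ ⋃₀ Γ.frame) → N ≤ p.length →
      LPA.mulStar F p p ∈ γ.nbhd F (k + 1) := by
  obtain ⟨C, hC⟩ := hγ.exists_sd_le
  refine ⟨(k + 1) * (C + C + 1), fun p hp hN => ?_⟩
  rw [nbhd_eq_span γ (by positivity)]
  refine Submodule.subset_span ⟨p, p, ?_, rfl⟩
  have h1 : (γ.sd p : ℝ) ≤ C := by exact_mod_cast hC p hp
  have h2 : ((k : ℝ) + 1) * (C + C + 1) ≤ p.length := by exact_mod_cast hN
  have h3 : (0 : ℝ) ≤ p.length := by positivity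
  rw [sub_self, abs_zero, add_zero]
  calc ((k : ℝ) + 1) * (γ.sd p + γ.sd p + 1) ≤ (k + 1) * (C + C + 1) := by gcongr
    _ ≤ p.length + p.length := by linarith

theorem coe_toLHat (a : LPA F Γ) : (γ.toLHat F a : γ.FullCompletion F) = γ.toFull F a := rfl

theorem proj_mem_homogClosure (p : Γ.Path) :
    (γ.proj F p : γ.FullCompletion F) ∈ γ.homogClosure F 0 := by
  have h := γ.toFull_mem_homogClosure F (Gen.vert p.src :: (p.edges.map Gen.edge ++
    ((p.edges.reverse.map Gen.ghost) ++ [Gen.vert p.src])))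
  have h1 : ((Gen.vert p.src :: (p.edges.map Gen.edge ++
    ((p.edges.reverse.map Gen.ghost) ++ [Gen.vert p.src]))).map
      (Gen.deg (V := V) (E := E))).sum = 0 := by
    simp [Function.comp_def, Gen.deg]
  rw [h1] at h
  convert h using 1
  rw [proj, coe_toLHat, LPA.mulStar, LPA.elt, LPA.eltStar]
  simp [Function.comp_def, mul_assoc]

/-- The sum `e(W)` converges. The limit lies in the graded completion since it is a limit of
elements of degree `0`. -/
theorem IsAdmissible.summable_proj (hγ : γ.IsAdmissible) {W : Set V} (hW : Γ.DescClosed W) :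
    Summable fun p : Γ.arr W => γ.proj F p := by
  have hind : Topology.IsInducing (γ.LHat F).val := Topology.IsInducing.subtypeVal
  have hs : Summable ((γ.LHat F).val ∘ fun p : Γ.arr W => γ.proj F p) := by
    rw [summable_iff_vanishing]
    intro U hU
    obtain ⟨k, hk⟩ := γ.exists_forall_mem_of_mem_nhds hU
    obtain ⟨N, hN⟩ := hγ.exists_mulStar_mem (F := F) k
    have hfin : {p : Γ.arr W | (p : Γ.Path).length < N}.Finite :=
      (finite_setOf_length_lt N).preimage Subtype.val_injective.injOn
    refine ⟨hfin.toFinset, fun t ht => ?_⟩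
    have : ∑ p ∈ t, ((γ.LHat F).val ∘ fun p : Γ.arr W => γ.proj F p) p =
        γ.toFull F (∑ p ∈ t, LPA.mulStar F (p : Γ.Path) p) := by
      rw [map_sum]
      rfl
    rw [this]
    refine hk _ (Submodule.sum_mem _ fun p hp => hN p (hW.arr_notMem_frame p.2) ?_)
    by_contra hlt
    exact Finset.disjoint_left.1 ht hp (by simpa using hlt)
  refine (hind.summable_iff_tsum_comp_mem_range _).2 ⟨hs, ⟨⟨_, ?_⟩, rfl⟩⟩
  refine Submodule.mem_iSup_of_mem (p := fun i => γ.homogClosure F i) 0 ?_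
  have hcl : IsClosed (γ.homogClosure F 0 : Set (γ.FullCompletion F)) :=
    Submodule.isClosed_topologicalClosure _
  exact tsum_mem hcl fun p => proj_mem_homogClosure _

variable {W : Set V}

theorem idem_empty : γ.idem F ∅ = 0 := by
  have : IsEmpty (Γ.arr ∅) := ⟨fun p => p.2.1⟩
  exact tsum_empty

/-! ### Centrality and idempotency -/

theorem IsAdmissible.idem_mul (hγ : γ.IsAdmissible) (hW : Γ.DescClosed W) (a : γ.LHat F) :
    γ.idem F W * a = ∑' p : Γ.arr W, γ.proj F p * a :=
  ((hγ.summable_proj hW).tsum_mul_right a).symm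

theorem IsAdmissible.mul_idem (hγ : γ.IsAdmissible) (hW : Γ.DescClosed W) (a : γ.LHat F) :
    a * γ.idem F W = ∑' p : Γ.arr W, a * γ.proj F p :=
  ((hγ.summable_proj hW).tsum_mul_left a).symm

theorem IsAdmissible.vert_commute_idem (hγ : γ.IsAdmissible) (hW : Γ.DescClosed W) (v : V) :
    Commute (γ.toLHat F (LPA.gen F Γ (.vert v))) (γ.idem F W) := by
  rw [Commute, SemiconjBy, hγ.idem_mul hW, hγ.mul_idem hW]
  exact tsum_congr fun p => (LPA.vert_commute_mulStar v p.1).map (γ.toLHat F)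

/-- For `w` in `W` the only arrival path from `w` is the trivial one, whence `w e(W) = w`. -/
theorem IsAdmissible.vert_mul_idem (hγ : γ.IsAdmissible) (hW : Γ.DescClosed W) {w : V}
    (hw : w ∈ W) : γ.toLHat F (LPA.gen F Γ (.vert w)) * γ.idem F W =
      γ.toLHat F (LPA.gen F Γ (.vert w)) := by
  have hnil : Γ.IsWalk w [] := trivial
  have harr : (⟨w, [], hnil⟩ : Γ.Path) ∈ Γ.arr W := ⟨hw, by simp⟩
  rw [hγ.mul_idem hW, tsum_eq_single ⟨_, harr⟩]
  · rw [proj, LPA.mulStar_nil, ← map_mul, LPA.vert_self]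
  · intro p hp
    rw [proj, ← map_mul, LPA.vert_mul_mulStar_ne, map_zero]
    rintro rfl
    exact hp (Subtype.ext (Path.ext rfl (edges_eq_nil_of_mem_arr p.2 hw)))

theorem IsAdmissible.idem_mul_vert (hγ : γ.IsAdmissible) (hW : Γ.DescClosed W) {w : V}
    (hw : w ∈ W) : γ.idem F W * γ.toLHat F (LPA.gen F Γ (.vert w)) =
      γ.toLHat F (LPA.gen F Γ (.vert w)) := by
  rw [← (hγ.vert_commute_idem hW w).eq, hγ.vert_mul_idem hW hw]

theorem IsAdmissible.edge_commute_idem (hγ : γ.IsAdmissible) (hW : Γ.DescClosed W) (e : E) :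
    Commute (γ.toLHat F (LPA.gen F Γ (.edge e))) (γ.idem F W) := by
  by_cases he : Γ.s e ∈ W
  · -- both products equal `e`, since `s(e)` and `r(e)` lie in `W`
    have hr : Γ.r e ∈ W := hW _ he _ (.edge e)
    rw [Commute, SemiconjBy]
    conv_lhs => rw [← LPA.edge_range, map_mul, mul_assoc, hγ.vert_mul_idem hW hr, ← map_mul,
      LPA.edge_range]
    conv_rhs => rw [← LPA.source_edge, map_mul, ← mul_assoc, hγ.idem_mul_vert hW he, ← map_mul,
      LPA.source_edge]
  · -- the nonzero terms `q q* e` of `e(W) e` are those with `q = e p`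
    calc γ.toLHat F (LPA.gen F Γ (.edge e)) * γ.idem F W
        = ∑' p : Γ.arr W, γ.toLHat F (LPA.gen F Γ (.edge e)) * γ.proj F p := hγ.mul_idem hW _
      _ = ∑' p : {p : Γ.arr W // p.1.src = Γ.r e},
            γ.toLHat F (LPA.gen F Γ (.edge e)) * γ.proj F p.1 := by
          refine (Subtype.val_injective.tsum_eq fun p hp => ?_).symm
          by_contra h
          refine hp ?_
          change _ * γ.toLHat F _ = 0
          rw [← map_mul, ← LPA.edge_range, mul_assoc, LPA.vert_mul_mulStar_ne, mul_zero, map_zero]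
          exact fun h' => h ⟨⟨p, h'.symm⟩, rfl⟩
      _ = ∑' p : {p : Γ.arr W // p.1.src = Γ.r e},
            γ.proj F (arrCons he p) * γ.toLHat F (LPA.gen F Γ (.edge e)) := by
          refine tsum_congr ?_
          rintro ⟨⟨⟨v, l, hl⟩, hp⟩, rfl : v = Γ.r e⟩
          change _ =
            γ.toLHat F (LPA.mulStar F ⟨Γ.s e, e :: l, rfl, hl⟩ ⟨Γ.s e, e :: l, rfl, hl⟩) * _
          rw [LPA.mulStar_cons e l hl, ← map_mul, mul_assoc, LPA.ghost_edge_self, mul_assoc,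
            LPA.mulStar_mul_vert ⟨Γ.r e, l, hl⟩, map_mul]
          rfl
      _ = ∑' p : Γ.arr W, γ.proj F p * γ.toLHat F (LPA.gen F Γ (.edge e)) := by
          refine (arrCons_injective he).tsum_eq
            (f := fun p : Γ.arr W => γ.proj F p * γ.toLHat F (LPA.gen F Γ (.edge e)))
            fun p hp => ?_
          by_contra h
          refine hp ?_
          change γ.toLHat F _ * _ = 0
          rw [← map_mul]
          obtain ⟨⟨v, _ | ⟨f, l⟩, hl⟩, hp'⟩ := p
          · rw [LPA.mulStar_nil, LPA.vert_mul_edge_ne, map_zero]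
            rintro rfl
            exact he hp'.1
          · obtain ⟨rfl, hl⟩ := hl
            have hfe : f ≠ e := by
              rintro rfl
              exact h ⟨⟨⟨⟨Γ.r f, l, hl⟩, hp'.1, fun g hg => hp'.2 g (List.mem_cons_of_mem _ hg)⟩,
                rfl⟩, rfl⟩
            rw [LPA.mulStar_cons f l hl, mul_assoc, LPA.ghost_edge_ne hfe, mul_zero, map_zero]
      _ = γ.idem F W * γ.toLHat F (LPA.gen F Γ (.edge e)) := (hγ.idem_mul hW _).symm

open Classical in
theorem toLHat_vert_eq_sum {v : V} (h : ¬ Γ.IsSink v) : γ.toLHat F (LPA.gen F Γ (.vert v)) =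
    ∑ e with Γ.s e = v,
      γ.toLHat F (LPA.gen F Γ (.edge e)) * γ.toLHat F (LPA.gen F Γ (.ghost e)) := by
  rw [LPA.vert_eq_sum h, map_sum]
  simp only [map_mul]

/-- The ghost edges commute with `e(W)` because the vertices and the edges do:
`e* x = ∑ e* x f f* = ∑ e* f x f* = x e*`, where `f` runs over the edges with source `s(e)`. -/
theorem IsAdmissible.ghost_commute_idem (hγ : γ.IsAdmissible) (hW : Γ.DescClosed W) (e : E) :
    Commute (γ.toLHat F (LPA.gen F Γ (.ghost e))) (γ.idem F W) := by
  classical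
  have hsink : ¬ Γ.IsSink (Γ.s e) := fun h => h e rfl
  rw [Commute, SemiconjBy]
  conv_lhs => rw [← LPA.ghost_source, map_mul, mul_assoc, (hγ.vert_commute_idem hW _).eq,
    toLHat_vert_eq_sum hsink, Finset.mul_sum, Finset.mul_sum]
  rw [Finset.sum_eq_single e]
  · rw [← mul_assoc (γ.idem F W), ← (hγ.edge_commute_idem hW e).eq, mul_assoc, ← mul_assoc,
      ← map_mul, LPA.ghost_edge_self, ← mul_assoc, (hγ.vert_commute_idem hW _).eq, mul_assoc,
      ← map_mul, LPA.range_ghost]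
  · intro f _ hf
    rw [← mul_assoc (γ.idem F W), ← (hγ.edge_commute_idem hW f).eq, mul_assoc, ← mul_assoc,
      ← map_mul, LPA.ghost_edge_ne hf.symm, map_zero, zero_mul]
  · intro h
    simp at h

theorem IsAdmissible.idem_commute (hγ : γ.IsAdmissible) (hW : Γ.DescClosed W) (x : γ.LHat F) :
    Commute (γ.idem F W) x := by
  have h1 : ∀ a : LPA F Γ, Commute (γ.toLHat F a) (γ.idem F W) := fun a => by
    induction a using LPA.induction_gen with
    | algebraMap c => rw [AlgHom.commutes]; exact Algebra.commutes c _
    | gen g =>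
      cases g with
      | vert v => exact hγ.vert_commute_idem hW v
      | edge e => exact hγ.edge_commute_idem hW e
      | ghost e => exact hγ.ghost_commute_idem hW e
    | add a b ha hb => rw [map_add]; exact ha.add_left hb
    | mul a b ha hb => rw [map_mul]; exact ha.mul_left hb
  -- `L(Γ)` is dense in its completion
  have h2 : ∀ y : γ.FullCompletion F, (γ.idem F W : γ.FullCompletion F) * y = y * γ.idem F W :=
    fun y => UniformSpace.Completion.induction_on y
      (isClosed_eq (continuous_const_mul _) (continuous_mul_const _))
      fun a => (congrArg Subtype.val (h1 ((γ.toTop F).symm a))).symm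
  exact Subtype.ext (h2 x)

theorem proj_eq (p : Γ.Path) : γ.proj F p = γ.toLHat F (LPA.elt F Γ p.src p.edges) *
    γ.toLHat F (LPA.gen F Γ (.vert p.tgt)) * γ.toLHat F (LPA.eltStar F Γ p.src p.edges) := by
  rw [proj, LPA.mulStar, ← map_mul, ← map_mul, LPA.elt_mul_vert_tgt]

theorem IsAdmissible.isIdempotentElem_idem (hγ : γ.IsAdmissible) (hW : Γ.DescClosed W) :
    IsIdempotentElem (γ.idem F W) := by
  rw [IsIdempotentElem]
  conv_lhs => rw [hγ.idem_mul hW]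
  refine tsum_congr fun p => ?_
  rw [proj_eq, mul_assoc, ← (hγ.idem_commute hW _).eq, ← mul_assoc, mul_assoc _ _ (γ.idem F W),
    hγ.vert_mul_idem hW p.2.1]

/-! ### The ideals `I(W)` -/

/-- `x ∈ I(W)` means `e(W) x = x`. -/
theorem IsAdmissible.mem_ideal_iff (hγ : γ.IsAdmissible) (hW : Γ.DescClosed W) {x : γ.LHat F} :
    x ∈ γ.ideal F W ↔ γ.idem F W * x = x := by
  constructor
  · intro hx
    have hx := (TwoSidedIdeal.mem_sInf _).1 hx (.mk' {x | γ.idem F W * x = x} (mul_zero _)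
      (fun {x y} hx hy => (mul_add _ x y).trans (congrArg₂ (· + ·) hx hy))
      (fun {x} hx => (mul_neg _ x).trans (congrArg Neg.neg hx))
      (fun {x y} hy => by
        change _ * y = y at hy
        change _ * (x * y) = x * y
        rw [← mul_assoc, (hγ.idem_commute hW x).eq, mul_assoc, hy])
      (fun {x y} hx => (mul_assoc _ x y).symm.trans (congrArg (· * y) hx))) ?_
    · exact (TwoSidedIdeal.mem_mk' {x | γ.idem F W * x = x} _ _ _ _ _ x).1 hx
    · refine ⟨?_, fun w hw => (TwoSidedIdeal.mem_mk' _ _ _ _ _ _ _).2 (hγ.idem_mul_vert hW hw)⟩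
      convert isClosed_eq (continuous_const_mul (γ.idem F W)) continuous_id using 1
      ext x
      exact TwoSidedIdeal.mem_mk' _ _ _ _ _ _ _
  · intro hx
    refine (TwoSidedIdeal.mem_sInf _).2 fun J hJ => ?_
    rw [← hx]
    refine J.mul_mem_right _ _ (tsum_mem (s := J) hJ.1 fun p => ?_)
    rw [proj_eq]
    exact J.mul_mem_right _ _ (J.mul_mem_left _ _ (hJ.2 _ p.2.1))

/-! ### Comparison of the idempotents of different sets -/

variable {W' : Set V}

/-- If a central `x` is annihilated by `W'`, then by the relation `v = ∑ e e*` the product `v x`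
only depends on an arbitrarily small part of `v`. -/
theorem exists_vert_mul_eq (hW' : Γ.DescClosed W') (hW : Γ.DescClosed W)
    (hd : ∀ v ∈ W, ∃ w ∈ W', Γ.IsDescendant v w) {x : γ.LHat F} (hx : ∀ a, Commute x a)
    (h0 : ∀ w ∈ W', γ.toLHat F (LPA.gen F Γ (.vert w)) * x = 0) (N : ℕ) :
    ∀ v ∈ W, ∃ y ∈ Submodule.span F {y | ∃ p : Γ.Path, p.src = v ∧ p.length = N ∧
        (∀ e ∈ p.edges, Γ.s e ∉ ⋃₀ Γ.frame) ∧ y = LPA.mulStar F p p},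
      γ.toLHat F (LPA.gen F Γ (.vert v)) * x = γ.toLHat F y * x := by
  classical
  induction N with
  | zero =>
    exact fun v _ => ⟨_, Submodule.subset_span ⟨⟨v, [], trivial⟩, rfl, rfl, by simp,
      (LPA.mulStar_nil v trivial).symm⟩, rfl⟩
  | succ N ih =>
    intro v hv
    by_cases hv' : v ∈ W'
    · exact ⟨0, Submodule.zero_mem _, by rw [h0 v hv', map_zero, zero_mul]⟩
    obtain ⟨w, hw, hvw⟩ := hd v hv
    have hfr : v ∉ ⋃₀ Γ.frame := hW'.notMem_frame hv' hw hvw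
    have hsink : ¬ Γ.IsSink v := by
      obtain ⟨⟨u, _ | ⟨e, l⟩, hl⟩, rfl, rfl⟩ := hvw
      · exact absurd hw hv'
      · exact fun h => h e hl.1
    have hr : ∀ e, Γ.s e = v → Γ.r e ∈ W := fun e he => hW v hv _ (he ▸ .edge e)
    have ih' : ∀ e : E, ∃ y, Γ.s e = v → y ∈ Submodule.span F {y | ∃ p : Γ.Path,
        p.src = Γ.r e ∧ p.length = N ∧ (∀ e ∈ p.edges, Γ.s e ∉ ⋃₀ Γ.frame) ∧
          y = LPA.mulStar F p p} ∧
        γ.toLHat F (LPA.gen F Γ (.vert (Γ.r e))) * x = γ.toLHat F y * x := fun e => by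
      by_cases he : Γ.s e = v
      · obtain ⟨y, hy⟩ := ih _ (hr e he)
        exact ⟨y, fun _ => hy⟩
      · exact ⟨0, fun h => absurd h he⟩
    choose y hy using ih'
    refine ⟨∑ e with Γ.s e = v, LPA.gen F Γ (.edge e) * y e * LPA.gen F Γ (.ghost e),
      Submodule.sum_mem _ fun e he => ?_, ?_⟩
    · obtain rfl : Γ.s e = v := by simpa using he
      have := (hy e rfl).1
      generalize y e = z at this
      induction this using Submodule.span_induction with
      | zero => simp
      | add a b _ _ ha hb => rw [mul_add, add_mul]; exact Submodule.add_mem _ ha hb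
      | smul c a _ ha => rw [mul_smul_comm, smul_mul_assoc]; exact Submodule.smul_mem _ _ ha
      | mem z hz =>
        obtain ⟨⟨u, l, hl⟩, rfl : u = _, hlen, hp, rfl⟩ := hz
        refine Submodule.subset_span ⟨⟨Γ.s e, e :: l, rfl, hl⟩, rfl, ?_, ?_,
          (LPA.mulStar_cons e l hl).symm⟩
        · exact congrArg (· + 1) hlen
        · intro f hf
          rcases List.mem_cons.1 hf with rfl | hf
          exacts [hfr, hp f hf]
    · rw [toLHat_vert_eq_sum hsink, map_sum, Finset.sum_mul, Finset.sum_mul]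
      refine Finset.sum_congr rfl fun e he => ?_
      have hye := (hy e (by simpa using he)).2
      rw [map_mul, map_mul, mul_assoc, ← (hx (γ.toLHat F (LPA.gen F Γ (.ghost e)))).eq]
      conv_lhs => rw [← LPA.edge_range, map_mul, mul_assoc,
        ← mul_assoc (γ.toLHat F (LPA.gen F Γ (.vert _))), hye]
      rw [mul_assoc, mul_assoc, mul_assoc, (hx (γ.toLHat F (LPA.gen F Γ (.ghost e)))).eq]

/-- The vertices of `W` lie in `I(W')` if all of them have a descendant in `W'`. -/
theorem IsAdmissible.vert_mul_idem_of_isDescendant (hγ : γ.IsAdmissible)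
    (hW' : Γ.DescClosed W') (hW : Γ.DescClosed W)
    (hd : ∀ v ∈ W, ∃ w ∈ W', Γ.IsDescendant v w) {v : V} (hv : v ∈ W) :
    γ.toLHat F (LPA.gen F Γ (.vert v)) * γ.idem F W' = γ.toLHat F (LPA.gen F Γ (.vert v)) := by
  set x : γ.LHat F := 1 - γ.idem F W' with hx
  suffices h : γ.toLHat F (LPA.gen F Γ (.vert v)) * x = 0 by
    rw [hx, mul_sub, mul_one, sub_eq_zero] at h
    exact h.symm
  have h0 : ∀ w ∈ W', γ.toLHat F (LPA.gen F Γ (.vert w)) * x = 0 := fun w hw => by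
    rw [hx, mul_sub, mul_one, hγ.vert_mul_idem hW' hw, sub_self]
  choose y hy hyx using fun N => exists_vert_mul_eq hW' hW hd
    (fun a => (Commute.one_left a).sub_left (hγ.idem_commute hW' a)) h0 N v hv
  have hlim : Filter.Tendsto (fun N => γ.toFull F (y N)) Filter.atTop (nhds 0) := by
    intro U hU
    obtain ⟨k, hk⟩ := γ.exists_forall_mem_of_mem_nhds hU
    obtain ⟨N, hN⟩ := hγ.exists_mulStar_mem (F := F) k
    refine Filter.mem_map.2 (Filter.mem_atTop_sets.2 ⟨N, fun n hn => hk _ ?_⟩)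
    refine (Submodule.span_le.2 ?_ : _ ≤ γ.nbhd F (k + 1)) (hy n)
    rintro _ ⟨p, -, hlen, hp, rfl⟩
    exact hN p hp (hlen ▸ hn)
  have hlim' := hlim.mul_const (x : γ.FullCompletion F)
  rw [zero_mul] at hlim'
  refine Subtype.ext (tendsto_nhds_unique (tendsto_const_nhds.congr fun N => ?_) hlim')
  exact congrArg Subtype.val (hyx N)

/-- Reduction of identities for `e(W)` to the vertices of `W`: `p p* x = p w x p*`, where `w ∈ W` is
the end of the arrival path `p`. -/
theorem IsAdmissible.idem_mul_eq (hγ : γ.IsAdmissible) (hW : Γ.DescClosed W)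
    {x : γ.LHat F} (hx : ∀ a, Commute x a)
    (h : ∀ w ∈ W, γ.toLHat F (LPA.gen F Γ (.vert w)) * x = γ.toLHat F (LPA.gen F Γ (.vert w))) :
    γ.idem F W * x = γ.idem F W := by
  rw [hγ.idem_mul hW]
  refine tsum_congr fun p => ?_
  rw [proj_eq, mul_assoc, ← (hx _).eq, ← mul_assoc, mul_assoc _ _ x, h _ p.2.1]

theorem IsAdmissible.idem_eq (hγ : γ.IsAdmissible) (hW' : Γ.DescClosed W')
    (hW : Γ.DescClosed W) (hsub : W' ⊆ W) (hd : ∀ v ∈ W, ∃ w ∈ W', Γ.IsDescendant v w) :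
    γ.idem F W' = γ.idem F W := by
  have h1 : γ.idem F W' * γ.idem F W = γ.idem F W' := hγ.idem_mul_eq hW' (hγ.idem_commute hW)
    fun w hw => hγ.vert_mul_idem hW (hsub hw)
  have h2 : γ.idem F W * γ.idem F W' = γ.idem F W := hγ.idem_mul_eq hW (hγ.idem_commute hW')
    fun w hw => hγ.vert_mul_idem_of_isDescendant hW' hW hd hw
  rw [← h1, (hγ.idem_commute hW' _).eq, h2]

theorem IsAdmissible.idem_mul_idem_of_disjoint (hγ : γ.IsAdmissible) (hW' : Γ.DescClosed W')
    (hW : Γ.DescClosed W) (h : Disjoint W W') : γ.idem F W * γ.idem F W' = 0 := by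
  have h0 : ∀ w ∈ W, γ.toLHat F (LPA.gen F Γ (.vert w)) * γ.idem F W' = 0 := fun w hw => by
    rw [hγ.mul_idem hW']
    refine (tsum_congr fun p => ?_).trans tsum_zero
    rw [proj, ← map_mul, LPA.vert_mul_mulStar_ne, map_zero]
    rintro rfl
    exact Set.disjoint_left.1 h (hW _ hw _ p.1.isDescendant) p.2.1
  have h1 := hγ.idem_mul_eq hW
    (fun a => (Commute.one_left a).sub_left (hγ.idem_commute hW' a))
    (fun w hw => by rw [mul_sub, mul_one, h0 w hw, sub_zero])
  rwa [mul_sub, mul_one, sub_eq_self] at h1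

theorem IsAdmissible.idem_union (hγ : γ.IsAdmissible) (hW' : Γ.DescClosed W')
    (hW : Γ.DescClosed W) (h : Disjoint W W') :
    γ.idem F (W ∪ W') = γ.idem F W + γ.idem F W' := by
  have hdisj : Disjoint (Γ.arr W) (Γ.arr W') :=
    Set.disjoint_left.2 fun p hp hp' => Set.disjoint_left.1 h hp.1 hp'.1
  rw [idem, arr_union_of_disjoint hW' hW h]
  exact Summable.tsum_union_disjoint (f := γ.proj F) hdisj (hγ.summable_proj hW)
    (hγ.summable_proj hW')

/-- `e(W) = 1` if every vertex has a descendant in `W`. -/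
theorem IsAdmissible.idem_eq_one (hγ : γ.IsAdmissible) (hW : Γ.DescClosed W)
    (hd : ∀ v, ∃ w ∈ W, Γ.IsDescendant v w) : γ.idem F W = 1 := by
  have h1 : (1 : γ.LHat F) = ∑ v, γ.toLHat F (LPA.gen F Γ (.vert v)) := by
    rw [← map_sum, LPA.sum_vert, map_one]
  conv_lhs => rw [← one_mul (γ.idem F W), h1, Finset.sum_mul]
  rw [h1]
  exact Finset.sum_congr rfl fun v _ => hγ.vert_mul_idem_of_isDescendant hW descClosed_univ
    (fun v _ => hd v) (Set.mem_univ v)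

theorem IsAdmissible.idem_add_idem_perp (hγ : γ.IsAdmissible) (hW : Γ.DescClosed W) :
    γ.idem F W + γ.idem F (Γ.perp W) = 1 := by
  rw [← hγ.idem_union (descClosed_perp W) hW disjoint_perp]
  refine hγ.idem_eq_one (hW.union (descClosed_perp W)) fun v => ?_
  by_cases hv : v ∈ Γ.perp W
  · exact ⟨v, Or.inr hv, .refl v⟩
  · obtain ⟨w, hw, h⟩ := exists_isDescendant_of_notMem_perp hv
    exact ⟨w, Or.inl hw, h⟩

theorem IsAdmissible.idem_perp_perp (hγ : γ.IsAdmissible) (hW : Γ.DescClosed W) :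
    γ.idem F W = γ.idem F (Γ.perp (Γ.perp W)) :=
  hγ.idem_eq hW (descClosed_perp _) hW.subset_perp_perp fun v hv =>
    exists_isDescendant_of_notMem_perp fun h => hv v h (.refl v)

theorem IsAdmissible.isCompl_ideal (hγ : γ.IsAdmissible) (hW : Γ.DescClosed W) :
    IsCompl (γ.ideal F W).asIdeal (γ.ideal F (Γ.perp W)).asIdeal := by
  constructor
  · rw [Submodule.disjoint_def]
    intro x hx hx'
    rw [TwoSidedIdeal.mem_asIdeal, hγ.mem_ideal_iff hW] at hx
    rw [TwoSidedIdeal.mem_asIdeal, hγ.mem_ideal_iff (descClosed_perp W)] at hx'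
    rw [← hx, ← hx', ← mul_assoc, hγ.idem_mul_idem_of_disjoint (descClosed_perp W) hW
      disjoint_perp, zero_mul]
  · rw [codisjoint_iff, Ideal.eq_top_iff_one, ← hγ.idem_add_idem_perp hW]
    exact Submodule.add_mem_sup ((hγ.mem_ideal_iff hW).2 (hγ.isIdempotentElem_idem hW))
      ((hγ.mem_ideal_iff (descClosed_perp W)).2 (hγ.isIdempotentElem_idem (descClosed_perp W)))

/-! ### The decomposition along the frame -/

theorem IsAdmissible.idem_sUnion (hγ : γ.IsAdmissible) (S : Finset (Set V))
    (hS : ∀ M ∈ S, M ∈ Γ.frame) : γ.idem F (⋃₀ (S : Set (Set V))) = ∑ M ∈ S, γ.idem F M := by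
  classical
  induction S using Finset.induction_on with
  | empty => rw [Finset.coe_empty, Set.sUnion_empty, idem_empty, Finset.sum_empty]
  | insert M S hM ih =>
    have hS' : ∀ M ∈ S, M ∈ Γ.frame := fun M hM => hS M (Finset.mem_insert_of_mem hM)
    have hMf := hS M (Finset.mem_insert_self M S)
    rw [Finset.coe_insert, Set.sUnion_insert, Finset.sum_insert hM, ← ih hS',
      hγ.idem_union (descClosed_sUnion fun M' hM' => descClosed_of_mem_frame (hS' M' hM'))
        (descClosed_of_mem_frame hMf)]
    refine Set.disjoint_sUnion_right.2 fun M' hM' => frame_disjoint hMf (hS' M' hM') ?_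
    rintro rfl
    exact hM hM'

/-- The idempotents of the frame are orthogonal with sum `1`. -/
theorem IsAdmissible.isInternal_ideal [DecidableEq Γ.frame] (hγ : γ.IsAdmissible) :
    DirectSum.IsInternal fun M : Γ.frame => (γ.ideal F (M : Set V)).asIdeal := by
  classical
  have hcl : ∀ M : Γ.frame, Γ.DescClosed (M : Set V) := fun M => descClosed_of_mem_frame M.2
  refine DirectSum.isInternal_submodule_of_iSupIndep_of_iSup_eq_top ?_ ?_
  · intro M
    rw [Submodule.disjoint_def]
    intro x hx hx'
    rw [TwoSidedIdeal.mem_asIdeal, hγ.mem_ideal_iff (hcl M)] at hx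
    -- `e(M)` annihilates the sum of the other ideals
    let K : Ideal (γ.LHat F) :=
      { carrier := {y | γ.idem F M * y = 0}
        add_mem' := fun {a b} ha hb => by
          change _ * (a + b) = 0
          rw [mul_add, show γ.idem F M * a = 0 from ha, show γ.idem F M * b = 0 from hb, add_zero]
        zero_mem' := mul_zero _
        smul_mem' := fun c y hy => by
          change _ * (c * y) = 0
          rw [← mul_assoc, (hγ.idem_commute (hcl M) c).eq, mul_assoc,
            show γ.idem F M * y = 0 from hy, mul_zero] }
    have hK : (⨆ M', ⨆ _ : M' ≠ M, (γ.ideal F (M' : Set V)).asIdeal) ≤ K := by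
      refine iSup₂_le fun M' hne y hy => ?_
      rw [TwoSidedIdeal.mem_asIdeal, hγ.mem_ideal_iff (hcl M')] at hy
      change _ * y = 0
      rw [← hy, ← mul_assoc, hγ.idem_mul_idem_of_disjoint (hcl M') (hcl M), zero_mul]
      exact frame_disjoint M.2 M'.2 fun h => hne (Subtype.ext h.symm)
    rw [← hx]
    exact hK hx'
  · rw [Ideal.eq_top_iff_one]
    have hfin : Γ.frame.Finite := Set.toFinite _
    have h1 : γ.idem F (⋃₀ Γ.frame) = 1 := hγ.idem_eq_one
      (descClosed_sUnion fun M hM => descClosed_of_mem_frame hM) exists_isDescendant_frame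
    have h2 := hγ.idem_sUnion (F := F) hfin.toFinset (by simp)
    rw [hfin.coe_toFinset, h1] at h2
    rw [h2]
    refine Submodule.sum_mem _ fun M hM => ?_
    have hM : M ∈ Γ.frame := by simpa using hM
    exact Submodule.mem_iSup_of_mem (p := fun M : Γ.frame => (γ.ideal F (M : Set V)).asIdeal)
      ⟨M, hM⟩ ((hγ.mem_ideal_iff (hcl ⟨M, hM⟩)).2 (hγ.isIdempotentElem_idem (hcl ⟨M, hM⟩)))

end Specialization

end Topology

end DirGraph

theorem lemma15 {V E : Type*} [Fintype V] [Fintype E] (F : Type*) [Field F]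
    (Γ : DirGraph V E) [DecidableEq Γ.frame] (γ : Γ.Specialization) (hγ : γ.IsAdmissible) :
    -- the sums `e(W)` converge, and they are central idempotents
    (∀ W : Set V, Γ.IsHereditary W →
      Summable (fun p : Γ.arr W => γ.proj F p) ∧
      IsIdempotentElem (γ.idem F W) ∧
      γ.idem F W ∈ Set.center (γ.LHat F)) ∧
    -- `e(W') = e(W'')` if `W' ⊆ W''` and every vertex of `W''` has a descendant in `W'`
    (∀ W' W'' : Set V, Γ.IsHereditary W' → Γ.IsHereditary W'' → W' ⊆ W'' →
      (∀ v ∈ W'', ∃ w ∈ W', Γ.IsDescendant v w) →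
      γ.idem F W' = γ.idem F W'') ∧
    -- `W^⊥` is empty or hereditary; `e(W)` and `e(W^⊥)` are orthogonal and sum to `1`
    (∀ W : Set V, Γ.IsHereditary W →
      (Γ.perp W = ∅ ∧ γ.idem F (Γ.perp W) = 0 ∨ Γ.IsHereditary (Γ.perp W)) ∧
      γ.idem F W * γ.idem F (Γ.perp W) = 0 ∧
      γ.idem F (Γ.perp W) * γ.idem F W = 0 ∧
      γ.idem F W + γ.idem F (Γ.perp W) = 1) ∧
    -- `e(W) = e((W^⊥)^⊥)`
    (∀ W : Set V, Γ.IsHereditary W →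
      γ.idem F W = γ.idem F (Γ.perp (Γ.perp W))) ∧
    -- `I(W) = e(W) L̂(Γ)`
    (∀ W : Set V, Γ.IsHereditary W →
      (γ.ideal F W : Set (γ.LHat F)) = Set.range fun a : γ.LHat F => γ.idem F W * a) ∧
    -- `L̂(Γ) = I(W) ⊕ I(W^⊥)`
    (∀ W : Set V, Γ.IsHereditary W →
      IsCompl (γ.ideal F W).asIdeal (γ.ideal F (Γ.perp W)).asIdeal) ∧
    -- `L̂(Γ)` is the direct sum of the `I(W_i)` over the frame
    DirectSum.IsInternal (fun W : Γ.frame => (γ.ideal F (W : Set V)).asIdeal) := by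
  refine ⟨fun W hW => ?_, fun W' W'' hW' hW'' hsub hd => ?_, fun W hW => ?_, fun W hW => ?_,
    fun W hW => ?_, fun W hW => ?_, hγ.isInternal_ideal⟩
  · exact ⟨hγ.summable_proj hW.2, hγ.isIdempotentElem_idem hW.2,
      Semigroup.mem_center_iff.2 fun x => (hγ.idem_commute hW.2 x).eq.symm⟩
  · exact hγ.idem_eq hW'.2 hW''.2 hsub hd
  · have hp := Γ.descClosed_perp W
    refine ⟨?_, hγ.idem_mul_idem_of_disjoint hp hW.2 DirGraph.disjoint_perp,
      hγ.idem_mul_idem_of_disjoint hW.2 hp DirGraph.disjoint_perp.symm,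
      hγ.idem_add_idem_perp hW.2⟩
    rcases (Γ.perp W).eq_empty_or_nonempty with h | h
    · exact Or.inl ⟨h, h ▸ DirGraph.Specialization.idem_empty⟩
    · exact Or.inr ⟨h, hp⟩
  · exact hγ.idem_perp_perp hW.2
  · ext x
    rw [SetLike.mem_coe, hγ.mem_ideal_iff hW.2, Set.mem_range]
    refine ⟨fun h => ⟨x, h⟩, ?_⟩
    rintro ⟨a, rfl⟩
    rw [← mul_assoc, (hγ.isIdempotentElem_idem hW.2).eq]
  · exact hγ.isCompl_ideal hW.2
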